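/- **Problem.** Let $J$ be a finite set of jobs with weights $w_j>0$, and let $\mathcal P_{\mathcal M}$ and $\mathcal P_{\mathcal R}$ be disjoint non-empty finite sets of Map and Reduce processors; every $i\in\mathcal P_{\mathcal R}$ is paired with an input processor of its own. Job $j$ has non-empty finite sets of Map tasks and of Reduce tasks, with processing times $p_{i,k,j}\ge 0$ on the Map processors $i$ and $p_{i,r,j}\ge 0$ on the Reduce processors $i$, and for every Reduce task $r$ and Map task $k$ of $j$ a Shuffle task $(r,k,j)$ with transfer time $t_{r,k,j}\ge 0$. All tasks are executed non-preemptively, no processor (Map, input or Reduce) executes two tasks at a time, Map tasks run on Map processors, Reduce tasks on Reduce processors, and the Shuffle tasks of a Reduce task that is assigned to $i$ run on the input processor of $i$. A Shuffle task starts after its Map task is completed, and a Reduce task after all its Shuffle tasks and all Map tasks of its job are completed. With $C_j$ the latest completion time of a Reduce task of $j$, the objective is to minimize $\sum_j w_jC_j$. **Algorithm TaskScheduling** for one set of tasks $\tau=(k,j)$ with times $p_{i,\tau}$ on a set of processors. Put $\delta=1/2$, $a=3/2$; measure time in a unit such that all positive processing times are at least $1$ (for integral times, the unit $1$). Let $L\ge1$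 be the least integer with $(1+\delta)^{L-1}\ge \sum_\tau\max_i p_{i,\tau}$. Tasks with processing time $0$ on some processor are put on such a processor and executed first; they take no part in the following. Take an optimal solution of the linear program: minimize $\sum_j w_jD_j$ subject to $D_j\ge0$, $y_{i,\tau,\ell}\ge 0$, $\sum_{i,\ell}y_{i,\tau,\ell}\ge1$, $D_j\ge C_\tau$ for every task $\tau$ of $j$, $\sum_{i,\ell}(1+\delta)^{\ell-1}y_{i,\tau,\ell}\le C_\tau$, $\sum_\tau p_{i,\tau}\sum_{t\le\ell}y_{i,\tau,t}\le(1+\delta)^\ell$, and $y_{i,\tau,\ell}=0$ if $p_{i,\tau}>(1+\delta)^\ell$ ($1\le\ell\le L$). Partition the tasks into classes $S(1),\dots,S(L)$ with $(1+\delta)^{\ell-1}\le aC_\tau\le(1+\delta)^\ell$ for $\tau\in S(\ell)$. For $\tau\in S(\ell)$ choose fractions $0\le x_{i,\tau}\le\frac a{a-1}\sum_{t\le\ell}y_{i,\tau,t}$ with $\sum_ix_{i,\tau}=1$, and round them, for every class separately, to an assignment of tasks to processors by the Shmoys–Tardos rounding (on every processor, lay the fractions out consecutively by non-increasing processing time,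 cut them into unit slots, and match every task to a slot which contains a positive part of it, no two tasks to the same slot). Every processor executes its tasks without idle time, class after class. **Algorithm MRS.** Run TaskScheduling on the Map tasks, giving $\sigma_{\mathcal M}$, and on the Shuffle-Reduce tasks, i.e. the Reduce tasks with times $p_{i,r,j}+\sum_kt_{r,k,j}$, giving $\sigma_{\mathcal R}$. Let $\omega_j$ be the maximum of the completion times of $j$ in $\sigma_{\mathcal M}$ and $\sigma_{\mathcal R}$. Keep the assignments to processors. Whenever a Map processor becomes available, it starts its unscheduled Map task of smallest $\omega_j$; whenever a Reduce processor becomes available at a time $t$, it starts, among its unscheduled Shuffle-Reduce tasks with $\omega_j\le t$, one of smallest $\omega_j$. A Shuffle-Reduce task executes first its Shuffle tasks, one after another, on the input processor, and then the Reduce task on the Reduce processor, while no other task occupies the two processors. **Corollary 1.** On every instance MRS computes a schedule, and, however its free choices (such as ties) are resolved: (1) the schedule $\sigma_{\mathcal R}$ is feasible for the Shuffle and Reduce tasks alone (Map tasks being disregarded), and its total weighted completion time is at most $27$ times that of every such feasible schedule on the input and Reduce processors; (2) the schedule computed by MRS is feasible, and its total weighted completion time is at most $81$ times that of every feasible schedule.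 That is, MRS is an $81$-approximation for the Map-Shuffle-Reduce problem when the Shuffle tasks run on processors different from those of the Reduce tasks. -/

import Mathlib

noncomputable section

namespace MapReduce

open Finset

/-! ### A single stage: jobs made of tasks, unrelated processors -/

/-- The tasks of a stage: `⟨j, k⟩` is the task with index `k` of job `j`. -/
abbrev Task {J : Type*} (T : J → Type*) := Σ j : J, T j

/-- The parameter `δ` of the geometric discretization of time. -/
def δ : ℝ := 1 / 2

/-- The parameter `a` of the partition of the tasks into classes. -/
def a : ℝ := 3 / 2

section Stage

variable {J P : Type*} {T : J → Type*}

/-- `u` is an admissible time unit: every positive processing time is at least `u`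
(for integral processing times, `u = 1`). -/
def IsTimeUnit (p : P → Task T → ℝ) (u : ℝ) : Prop :=
  0 < u ∧ ∀ i τ, 0 < p i τ → u ≤ p i τ

/-- A task that takes no time on some processor. -/
def IsNull (p : P → Task T → ℝ) (τ : Task T) : Prop := ∃ i, p i τ = 0

/-- The right end point `u (1 + δ) ^ ℓ` of the `ℓ`-th interval of time. -/
def grid (u : ℝ) (l : ℕ) : ℝ := u * (1 + δ) ^ l

variable [Fintype J] [Fintype P] [Nonempty P] [∀ j, Fintype (T j)]

/-- The time horizon `∑ maxᵢ pᵢ`. -/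
def tmax (p : P → Task T → ℝ) : ℝ :=
  ∑ τ : Task T, univ.sup' univ_nonempty (fun i => p i τ)

/-- The number `L` of intervals: the least `L ≥ 1` with `u (1 + δ) ^ (L - 1) ≥ tmax`. -/
def numIntervals (p : P → Task T → ℝ) (u : ℝ) : ℕ :=
  sInf {L : ℕ | 1 ≤ L ∧ tmax p ≤ grid u (L - 1)}

open Classical in
/-- Feasible solutions of the interval-indexed linear program of a stage. The variable `y i τ l`
says which fraction of `τ` completes on `i` in the `l`-th interval, `C τ` is the completion time of
the task `τ`, and `D j` that of the job `j`. Null tasks take no part in the program. -/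
structure LPFeasible (p : P → Task T → ℝ) (u : ℝ)
    (y : P → Task T → ℕ → ℝ) (C : Task T → ℝ) (D : J → ℝ) : Prop where
  cover : ∀ τ, ¬ IsNull p τ → 1 ≤ ∑ i, ∑ l ∈ Icc 1 (numIntervals p u), y i τ l
  job : ∀ τ, ¬ IsNull p τ → C τ ≤ D τ.1
  job_nonneg : ∀ j, 0 ≤ D j
  completion : ∀ τ, ¬ IsNull p τ →
    ∑ i, ∑ l ∈ Icc 1 (numIntervals p u), grid u (l - 1) * y i τ l ≤ C τ
  load : ∀ i, ∀ l ∈ Icc 1 (numIntervals p u),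
    ∑ τ ∈ univ.filter (fun τ => ¬ IsNull p τ), p i τ * ∑ t ∈ Icc 1 l, y i τ t ≤ grid u l
  prune : ∀ i τ, ¬ IsNull p τ → ∀ l ∈ Icc 1 (numIntervals p u), grid u l < p i τ → y i τ l = 0
  nonneg : ∀ i τ, ¬ IsNull p τ → ∀ l ∈ Icc 1 (numIntervals p u), 0 ≤ y i τ l

/-- Optimal solutions of the linear program, with objective `∑ j, w j * D j`. -/
structure LPOptimal (w : J → ℝ) (p : P → Task T → ℝ) (u : ℝ)
    (y : P → Task T → ℕ → ℝ) (C : Task T → ℝ) (D : J → ℝ) : Prop where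
  feasible : LPFeasible p u y C D
  optimal : ∀ y' C' D', LPFeasible p u y' C' D' → ∑ j, w j * D j ≤ ∑ j, w j * D' j

open Classical in
/-- The rounding of Shmoys and Tardos, applied to each class of non-null tasks separately. On every
processor `i` the tasks of the class are sorted by non-increasing processing time (`rank i`), their
fractions `x i τ` are laid out consecutively in this order on a half-line, and the half-line is cut
into unit slots `(s, s + 1)`. The integral assignment is a matching, in the bipartite graph of
tasks and slots that overlap, which covers every task. -/
structure IsRounding (p : P → Task T → ℝ) (cls : Task T → ℕ) (x : P → Task T → ℝ)
    (rank : P → Task T → ℕ) (slot : Task T → ℕ) (proc : Task T → P) : Prop where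
  rank_injective : ∀ i, Function.Injective (rank i)
  sorted : ∀ i τ τ', cls τ = cls τ' → rank i τ < rank i τ' → p i τ' ≤ p i τ
  support : ∀ τ, ¬ IsNull p τ → 0 < x (proc τ) τ
  begins : ∀ τ, ¬ IsNull p τ →
    ∑ τ' ∈ univ.filter (fun τ' => cls τ' = cls τ ∧ rank (proc τ) τ' < rank (proc τ) τ),
      x (proc τ) τ' < slot τ + 1
  ends : ∀ τ, ¬ IsNull p τ →
    (slot τ : ℝ) <
      ∑ τ' ∈ univ.filter (fun τ' => cls τ' = cls τ ∧ rank (proc τ) τ' < rank (proc τ) τ),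
        x (proc τ) τ' + x (proc τ) τ
  matching : ∀ τ τ', ¬ IsNull p τ → ¬ IsNull p τ' → cls τ = cls τ' →
    proc τ = proc τ' → slot τ = slot τ' → τ = τ'

/-- An execution of the algorithm TaskScheduling on one stage, for the time unit `u`.
All choices which the algorithm leaves open (optimal solution, ties, matching, order inside a
class) are arbitrary. -/
structure TaskSchedulingRun (w : J → ℝ) (p : P → Task T → ℝ) (u : ℝ) where
  /-- an optimal fractional solution of the linear program -/
  y : P → Task T → ℕ → ℝ
  C : Task T → ℝ
  D : J → ℝ
  optimal : LPOptimal w p u y C D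
  /-- the class of each task; null tasks form the class `0` -/
  cls : Task T → ℕ
  cls_null : ∀ τ, IsNull p τ → cls τ = 0
  cls_mem : ∀ τ, ¬ IsNull p τ → cls τ ∈ Icc 1 (numIntervals p u)
  cls_lower : ∀ τ, ¬ IsNull p τ → grid u (cls τ - 1) ≤ a * C τ
  cls_upper : ∀ τ, ¬ IsNull p τ → a * C τ ≤ grid u (cls τ)
  /-- the fractional assignment: the solution is cut off after the interval of the class, scaled up
  by `a / (a - 1)`, and whatever then exceeds a total of one is discarded -/
  x : P → Task T → ℝ
  x_nonneg : ∀ i τ, ¬ IsNull p τ → 0 ≤ x i τ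
  x_le : ∀ i τ, ¬ IsNull p τ → x i τ ≤ ∑ t ∈ Icc 1 (cls τ), a / (a - 1) * y i τ t
  x_sum : ∀ τ, ¬ IsNull p τ → ∑ i, x i τ = 1
  /-- the integral assignment of the tasks to the processors -/
  proc : Task T → P
  rank : P → Task T → ℕ
  slot : Task T → ℕ
  rounding : IsRounding p cls x rank slot proc
  proc_null : ∀ τ, IsNull p τ → p (proc τ) τ = 0
  /-- the order in which the processors execute their tasks: class after class -/
  pos : Task T → ℕ
  pos_injective : Function.Injective pos
  pos_cls : ∀ τ τ', cls τ < cls τ' → pos τ < pos τ'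

namespace TaskSchedulingRun

variable {w : J → ℝ} {p : P → Task T → ℝ} {u : ℝ}

open Classical in
/-- The starting time of a task in the computed schedule (no processor is ever idle between two
tasks). -/
def start (A : TaskSchedulingRun w p u) (τ : Task T) : ℝ :=
  ∑ τ' ∈ univ.filter (fun τ' => A.proc τ' = A.proc τ ∧ A.pos τ' < A.pos τ), p (A.proc τ) τ'

/-- The completion time of a job in the computed schedule of the stage. -/
def jobCompletion [∀ j, Nonempty (T j)] (A : TaskSchedulingRun w p u) (j : J) : ℝ :=
  univ.sup' univ_nonempty (fun k : T j => A.start ⟨j, k⟩ + p (A.proc ⟨j, k⟩) ⟨j, k⟩)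

end TaskSchedulingRun

end Stage

/-- List scheduling on fixed processors: whenever a processor becomes available, it starts, among
its unscheduled tasks that are already released, one of the smallest width. -/
structure IsGreedy {X P : Type*} (proc : X → P) (dur release width start : X → ℝ) : Prop where
  released : ∀ τ, release τ ≤ start τ
  sequential : ∀ τ τ', τ ≠ τ' → proc τ = proc τ' →
    start τ + dur τ ≤ start τ' ∨ start τ' + dur τ' ≤ start τ
  busy : ∀ (i : P) (t : ℝ), (∀ τ, proc τ = i → t ∉ Set.Ico (start τ) (start τ + dur τ)) →
    ∀ τ, proc τ = i → release τ ≤ t → start τ ≤ t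
  smallest : ∀ τ τ', proc τ = proc τ' → start τ < start τ' → release τ' ≤ start τ →
    width τ ≤ width τ'

/-! ### The Map-Shuffle-Reduce problem with separate input processors -/

/-- An instance: jobs `J`, Map processors `PM`, Reduce processors `PR`; job `j` has Map tasks `M j`,
Reduce tasks `R j`, and one Shuffle task for each pair of a Reduce task and a Map task of `j`. -/
structure Instance (J PM PR : Type*) (M R : J → Type*) where
  weight : J → ℝ
  weight_pos : ∀ j, 0 < weight j
  mapTime : PM → Task M → ℝ
  mapTime_nonneg : ∀ i τ, 0 ≤ mapTime i τ
  reduceTime : PR → Task R → ℝ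
  reduceTime_nonneg : ∀ i τ, 0 ≤ reduceTime i τ
  shuffleTime : ∀ j, R j → M j → ℝ
  shuffleTime_nonneg : ∀ j r k, 0 ≤ shuffleTime j r k

/-- A schedule of the Shuffle and Reduce tasks. Every Reduce processor is paired with its own input
processor; the Shuffle tasks of a Reduce task assigned to `i` run on the input processor of `i`. -/
structure SRSchedule (J PR : Type*) (M R : J → Type*) where
  reduceProc : Task R → PR
  reduceStart : Task R → ℝ
  shuffleStart : ∀ j, R j → M j → ℝ

/-- A schedule of the Map, Shuffle and Reduce tasks. -/
structure Schedule (J PM PR : Type*) (M R : J → Type*) extends SRSchedule J PR M R where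
  mapProc : Task M → PM
  mapStart : Task M → ℝ

section Problem

variable {J PM PR : Type*} {M R : J → Type*}

namespace SRSchedule

/-- The completion time of a Reduce task. -/
def completion (S : SRSchedule J PR M R) (I : Instance J PM PR M R) (τ : Task R) : ℝ :=
  S.reduceStart τ + I.reduceTime (S.reduceProc τ) τ

/-- Feasibility of a schedule of the Shuffle and Reduce tasks alone: no processor executes two tasks
at a time, and a Reduce task starts after all its Shuffle tasks. -/
structure Feasible (S : SRSchedule J PR M R) (I : Instance J PM PR M R) : Prop where
  shuffle_nonneg : ∀ j r k, 0 ≤ S.shuffleStart j r k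
  reduce_nonneg : ∀ τ, 0 ≤ S.reduceStart τ
  shuffle_disjoint : ∀ (j j' : J) (r : R j) (k : M j) (r' : R j') (k' : M j'),
    (⟨j, (r, k)⟩ : Σ j, R j × M j) ≠ ⟨j', (r', k')⟩ →
    S.reduceProc ⟨j, r⟩ = S.reduceProc ⟨j', r'⟩ →
    Disjoint
      (Set.Ico (S.shuffleStart j r k) (S.shuffleStart j r k + I.shuffleTime j r k))
      (Set.Ico (S.shuffleStart j' r' k') (S.shuffleStart j' r' k' + I.shuffleTime j' r' k'))
  reduce_disjoint : ∀ τ τ', τ ≠ τ' → S.reduceProc τ = S.reduceProc τ' →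
    Disjoint (Set.Ico (S.reduceStart τ) (S.completion I τ))
      (Set.Ico (S.reduceStart τ') (S.completion I τ'))
  shuffle_reduce : ∀ j r k, S.shuffleStart j r k + I.shuffleTime j r k ≤ S.reduceStart ⟨j, r⟩

variable [Fintype J] [∀ j, Fintype (R j)] [∀ j, Nonempty (R j)]

/-- The completion time of a job: the last completion time of its Reduce tasks. -/
def jobCompletion (S : SRSchedule J PR M R) (I : Instance J PM PR M R) (j : J) : ℝ :=
  univ.sup' univ_nonempty (fun r : R j => S.completion I ⟨j, r⟩)

/-- The total weighted completion time. -/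
def cost (S : SRSchedule J PR M R) (I : Instance J PM PR M R) : ℝ :=
  ∑ j, I.weight j * S.jobCompletion I j

end SRSchedule

/-- Feasibility of a schedule of all tasks: in addition, no Map processor executes two tasks at a
time, and a Shuffle task starts after its Map task. -/
structure Schedule.Feasible (S : Schedule J PM PR M R) (I : Instance J PM PR M R) : Prop where
  shuffleReduce : S.toSRSchedule.Feasible I
  map_nonneg : ∀ τ, 0 ≤ S.mapStart τ
  map_disjoint : ∀ τ τ', τ ≠ τ' → S.mapProc τ = S.mapProc τ' →
    Disjoint (Set.Ico (S.mapStart τ) (S.mapStart τ + I.mapTime (S.mapProc τ) τ))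
      (Set.Ico (S.mapStart τ') (S.mapStart τ' + I.mapTime (S.mapProc τ') τ'))
  map_shuffle : ∀ j r k,
    S.mapStart ⟨j, k⟩ + I.mapTime (S.mapProc ⟨j, k⟩) ⟨j, k⟩ ≤ S.shuffleStart j r k
  map_reduce : ∀ j k r,
    S.mapStart ⟨j, k⟩ + I.mapTime (S.mapProc ⟨j, k⟩) ⟨j, k⟩ ≤ S.reduceStart ⟨j, r⟩

section Algorithm

variable [∀ j, Fintype (M j)]

/-- The total transfer time of the Shuffle tasks of a Reduce task. -/
def Instance.shuffleTotal (I : Instance J PM PR M R) (τ : Task R) : ℝ :=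
  ∑ k, I.shuffleTime τ.1 τ.2 k

/-- The processing time of a Shuffle-Reduce task. -/
def Instance.shuffleReduceTime (I : Instance J PM PR M R) (i : PR) (τ : Task R) : ℝ :=
  I.reduceTime i τ + I.shuffleTotal τ

open Classical in
/-- The schedule in which every Shuffle-Reduce task `τ` occupies, from time `block τ` on, the
processor `proc τ` and its input processor: first its Shuffle tasks, consecutively and ordered by
`order`, on the input processor, and immediately afterwards the Reduce task on `proc τ`. -/
def SRSchedule.ofBlocks (I : Instance J PM PR M R) (proc : Task R → PR) (block : Task R → ℝ)
    (order : ∀ j, R j → M j → ℕ) : SRSchedule J PR M R where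
  reduceProc := proc
  reduceStart τ := block τ + I.shuffleTotal τ
  shuffleStart j r k :=
    block ⟨j, r⟩ + ∑ k' ∈ univ.filter (fun k' => order j r k' < order j r k), I.shuffleTime j r k'

variable [Fintype J] [Fintype PM] [Nonempty PM] [Fintype PR] [Nonempty PR]
  [∀ j, Nonempty (M j)] [∀ j, Fintype (R j)] [∀ j, Nonempty (R j)]

/-- The width of a job: the larger one of its completion times in the schedules of the two
stages. -/
def width {I : Instance J PM PR M R} {u : ℝ} (A : TaskSchedulingRun I.weight I.mapTime u)
    (B : TaskSchedulingRun I.weight I.shuffleReduceTime u) (j : J) : ℝ :=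
  max (A.jobCompletion j) (B.jobCompletion j)

/-- An execution of the algorithm MRS: TaskScheduling is run on the Map tasks and on the
Shuffle-Reduce tasks; the tasks stay on their processors and are list-scheduled there by smallest
width, the Map tasks without release times and the Shuffle-Reduce tasks of job `j` with its width as
the release time. -/
structure MRSRun (I : Instance J PM PR M R) (u : ℝ) where
  mapRun : TaskSchedulingRun I.weight I.mapTime u
  srRun : TaskSchedulingRun I.weight I.shuffleReduceTime u
  /-- the order in which the Shuffle tasks of a Reduce task are executed -/
  order : ∀ j, R j → M j → ℕ
  order_injective : ∀ j r, Function.Injective (order j r)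
  mapStart : Task M → ℝ
  map_greedy : IsGreedy mapRun.proc (fun τ => I.mapTime (mapRun.proc τ) τ)
    (fun _ => 0) (fun τ => width mapRun srRun τ.1) mapStart
  /-- the starting times of the Shuffle-Reduce tasks -/
  block : Task R → ℝ
  sr_greedy : IsGreedy srRun.proc (fun τ => I.shuffleReduceTime (srRun.proc τ) τ)
    (fun τ => width mapRun srRun τ.1) (fun τ => width mapRun srRun τ.1) block

namespace MRSRun

variable {I : Instance J PM PR M R} {u : ℝ}

/-- The schedule computed by TaskScheduling for the Shuffle-Reduce stage alone. -/
def stageSchedule (A : MRSRun I u) : SRSchedule J PR M R :=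
  SRSchedule.ofBlocks I A.srRun.proc A.srRun.start A.order

/-- The final schedule, computed by MRS. -/
def schedule (A : MRSRun I u) : Schedule J PM PR M R where
  toSRSchedule := SRSchedule.ofBlocks I A.srRun.proc A.block A.order
  mapProc := A.mapRun.proc
  mapStart := A.mapStart

end MRSRun

end Algorithm

end Problem

end MapReduce

end

/-! Both ratios rest on one bound for a single stage: in every run a task completes within `27 / 2`
times the LP value `D` of its job (`start_add_le_mul`). Consider a task of class `c` on processor
`i`. The fractional load that the classes up to `c` put on `i` is at most `a / (a - 1) = 3` times
the LP load, hence at most `3 * grid u c`. The Shmoys–Tardos rounding adds at most one task of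
length `grid u l` per class `l` (`sum_matched_le`, `class_load`), and these form a geometric sum of
at most `3 * grid u c`. Altogether this is `6 * grid u c = 9 * grid u (c - 1)`, and the choice of
the class gives `grid u (c - 1) ≤ 3 / 2 * C`.

The linear program relaxes every schedule in which the tasks completed by `t` on a processor take at
most `t` (`exists_lpFeasible`). Map schedules have this property as they stand, so the Map stage
loses `27 / 2`. Merged Shuffle-Reduce tasks run on two processors at once, so their load by `t` is
only bounded by `2 * t`; doubling all completion times restores the property, and this stage loses
`27`.

List scheduling by width `ω` delays a task only by tasks of no larger width on its processor, and
these fit into `[0, ω]` in the stage schedule. Hence Map tasks end by `ω` and Shuffle-Reduce blocks,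
released at `ω`, by `2 * ω`; the release time also makes the combined schedule feasible. Since `ω`
is at most the sum of the two stage completion times, the final ratio is `2 * (27 / 2 + 27) = 81`.

Runs exist by compactness (LP optimum), a Markov estimate (fractions), Hall's theorem (matching) and
insertion in the order of width (list schedules). -/

noncomputable section

namespace MapReduce

open Finset

/-! ### Length comparisons for families of half-open intervals. -/

section Intervals

open MeasureTheory

variable {ι κ : Type*}

/-- If every point of some pairwise disjoint intervals is covered by other intervals, then the
total length of the former is at most that of the latter. -/
theorem sum_le_sum_of_Ico_cover (s : Finset ι) (s' : Finset κ) (f d : ι → ℝ) (f' d' : κ → ℝ)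
    (hd : ∀ k ∈ s, 0 ≤ d k) (hd' : ∀ k ∈ s', 0 ≤ d' k)
    (hdisj : ∀ k ∈ s, ∀ k' ∈ s, k ≠ k' →
      Disjoint (Set.Ico (f k) (f k + d k)) (Set.Ico (f k') (f k' + d k')))
    (hcov : ∀ k ∈ s, ∀ v, f k ≤ v → v < f k + d k → ∃ k' ∈ s', f' k' ≤ v ∧ v < f' k' + d' k') :
    ∑ k ∈ s, d k ≤ ∑ k ∈ s', d' k := by
  have h1 : volume (⋃ k ∈ s, Set.Ico (f k) (f k + d k)) = ∑ k ∈ s, ENNReal.ofReal (d k) := by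
    rw [measure_biUnion_finset (fun k hk k' hk' h => hdisj k hk k' hk' h)
      (fun k _ => measurableSet_Ico)]
    simp
  have h2 : (⋃ k ∈ s, Set.Ico (f k) (f k + d k)) ⊆ ⋃ k ∈ s', Set.Ico (f' k) (f' k + d' k) :=
    Set.iUnion₂_subset fun k hk v hv => by
      obtain ⟨k', hk', h⟩ := hcov k hk v hv.1 hv.2
      exact Set.mem_iUnion₂.2 ⟨k', hk', h⟩
  have h3 := (measure_mono (μ := volume) h2).trans (measure_biUnion_finset_le s' _)
  simp only [h1, Real.volume_Ico, add_sub_cancel_left] at h3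
  rw [← ENNReal.ofReal_sum_of_nonneg hd, ← ENNReal.ofReal_sum_of_nonneg hd'] at h3
  exact (ENNReal.ofReal_le_ofReal_iff (sum_nonneg hd')).1 h3

/-- Pairwise disjoint intervals inside `[0, t)` have total length at most `t`. -/
theorem sum_le_of_disjoint_Ico (s : Finset ι) (f d : ι → ℝ) {t : ℝ} (ht : 0 ≤ t)
    (hd : ∀ k ∈ s, 0 ≤ d k) (hf : ∀ k ∈ s, 0 ≤ f k) (hft : ∀ k ∈ s, f k + d k ≤ t)
    (hdisj : ∀ k ∈ s, ∀ k' ∈ s, k ≠ k' →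
      Disjoint (Set.Ico (f k) (f k + d k)) (Set.Ico (f k') (f k' + d k'))) :
    ∑ k ∈ s, d k ≤ t := by
  simpa using sum_le_sum_of_Ico_cover s ({()} : Finset Unit) f d (fun _ => 0) (fun _ => t) hd
    (fun _ _ => ht) hdisj fun k hk v h1 h2 => ⟨(), by simp, (hf k hk).trans h1, by
      linarith [hft k hk]⟩

/-- An interval which is covered by intervals is at most as long as all of them together. -/
theorem sub_le_sum_of_Ico_cover (s : Finset ι) (f d : ι → ℝ) {b c : ℝ}
    (hd : ∀ k ∈ s, 0 ≤ d k)
    (hcov : ∀ v, b ≤ v → v < c → ∃ k ∈ s, f k ≤ v ∧ v < f k + d k) :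
    c - b ≤ ∑ k ∈ s, d k := by
  rcases le_total c b with h | h
  · exact (sub_nonpos.2 h).trans (sum_nonneg hd)
  simpa using sum_le_sum_of_Ico_cover ({()} : Finset Unit) s (fun _ => b) (fun _ => c - b) f d
    (fun _ _ => sub_nonneg.2 h) hd (by simp) fun _ _ v h1 h2 => hcov v h1 (by linarith)

end Intervals

/-! ### Consecutive layout of pieces on a half-line. -/

section Layout

variable {X : Type*}

/-- The left end of the piece of `τ` when the pieces `x` of the elements of `s` are laid out
consecutively in the order of `r`. -/
def offset (s : Finset X) (r : X → ℕ) (x : X → ℝ) (τ : X) : ℝ :=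
  ∑ τ' ∈ s.filter (fun τ' => r τ' < r τ), x τ'

variable {s : Finset X} {r : X → ℕ} {x : X → ℝ}

theorem offset_nonneg (hx : ∀ τ ∈ s, 0 ≤ x τ) (τ : X) : 0 ≤ offset s r x τ :=
  sum_nonneg fun τ' h => hx τ' (mem_filter.1 h).1

theorem offset_add (hr : Function.Injective r) {τ : X} (hτ : τ ∈ s) :
    offset s r x τ + x τ = ∑ τ' ∈ s.filter (fun τ' => r τ' ≤ r τ), x τ' := by
  classical
  have : s.filter (fun τ' => r τ' ≤ r τ) = insert τ (s.filter (fun τ' => r τ' < r τ)) := by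
    ext τ'
    simp only [mem_filter, mem_insert, le_iff_lt_or_eq, hr.eq_iff]
    constructor
    · tauto
    · rintro (rfl | h)
      · exact ⟨hτ, Or.inr rfl⟩
      · exact ⟨h.1, Or.inl h.2⟩
  rw [this, sum_insert (by simp), add_comm, offset]

theorem offset_add_le (hr : Function.Injective r) (hx : ∀ τ ∈ s, 0 ≤ x τ) {τ τ' : X} (hτ : τ ∈ s)
    (h : r τ < r τ') : offset s r x τ + x τ ≤ offset s r x τ' := by
  rw [offset_add hr hτ]
  refine sum_le_sum_of_subset_of_nonneg (fun σ hσ => ?_) fun σ hσ _ => hx σ (mem_filter.1 hσ).1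
  simp only [mem_filter] at hσ ⊢
  exact ⟨hσ.1, by lia⟩

theorem offset_disjoint (hr : Function.Injective r) (hx : ∀ τ ∈ s, 0 ≤ x τ) {τ τ' : X} (hτ : τ ∈ s)
    (hτ' : τ' ∈ s) (hne : τ ≠ τ') :
    Disjoint (Set.Ico (offset s r x τ) (offset s r x τ + x τ))
      (Set.Ico (offset s r x τ') (offset s r x τ' + x τ')) := by
  rw [Set.disjoint_left]
  rintro v ⟨h1, h2⟩ ⟨h3, h4⟩
  rcases lt_or_gt_of_ne (hr.ne hne) with h | h
  · linarith [offset_add_le hr hx hτ h]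
  · linarith [offset_add_le hr hx hτ' h]

/-- The pieces up to that of `τ` leave no gaps. -/
theorem exists_offset_le (hr : Function.Injective r) {τ : X} (hτ : τ ∈ s)
    {v : ℝ} (hv : 0 ≤ v) (hvτ : v < offset s r x τ + x τ) :
    ∃ σ ∈ s, r σ ≤ r τ ∧ offset s r x σ ≤ v ∧ v < offset s r x σ + x σ := by
  -- Take the first piece that ends after `v`. Its predecessor, if any, ends by `v`, and that end is
  -- where the piece begins.
  obtain ⟨σ, hσ, hmin⟩ := exists_min_image
    (s.filter fun σ => r σ ≤ r τ ∧ v < offset s r x σ + x σ) r ⟨τ, by simp [hτ, hvτ]⟩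
  simp only [mem_filter] at hσ hmin
  refine ⟨σ, hσ.1, hσ.2.1, ?_, hσ.2.2⟩
  rcases (s.filter fun ρ => r ρ < r σ).eq_empty_or_nonempty with h | h
  · simpa [offset, h] using hv
  · obtain ⟨ρ, hρ, hmax⟩ := exists_max_image _ r h
    simp only [mem_filter] at hρ hmax
    have : offset s r x σ = offset s r x ρ + x ρ := by
      rw [offset_add hr hρ.1, offset]
      congr 1
      ext π
      simp only [mem_filter]
      constructor
      · exact fun h => ⟨h.1, hmax π h⟩
      · exact fun h => ⟨h.1, by lia⟩
    rw [this]
    by_contra! hlt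
    have := hmin ρ ⟨hρ.1, by lia, hlt⟩
    lia

/-- Every finite type can be listed in the order of a given function. -/
theorem exists_sorting [Finite X] {α : Type*} [LinearOrder α] (f : X → α) :
    ∃ r : X → ℕ, Function.Injective r ∧ ∀ τ τ', r τ < r τ' → f τ ≤ f τ' := by
  have := Fintype.ofFinite X
  let e := Fintype.equivFin X
  let σ := Tuple.sort (f ∘ e.symm)
  refine ⟨fun τ => (σ.symm (e τ) : ℕ), fun τ τ' h => ?_, fun τ τ' h => ?_⟩
  · exact e.injective (σ.symm.injective (Fin.ext h))
  · have := Tuple.monotone_sort (f ∘ e.symm) (Fin.le_def.2 h.le)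
    simpa [σ] using this

end Layout

/-! ### The interval-indexed linear program: relaxation and existence of optima. -/

section LinearProgram

theorem grid_pos {u : ℝ} (hu : 0 < u) (l : ℕ) : 0 < grid u l := by
  unfold grid δ; positivity

theorem grid_succ (u : ℝ) (l : ℕ) : grid u (l + 1) = 3 / 2 * grid u l := by
  unfold grid δ; ring

theorem grid_zero (u : ℝ) : grid u 0 = u := by simp [grid]

theorem grid_eq_mul_grid_pred (u : ℝ) {l : ℕ} (hl : 1 ≤ l) : grid u l = 3 / 2 * grid u (l - 1) := by
  obtain ⟨k, rfl⟩ := Nat.exists_eq_add_of_le' hl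
  exact grid_succ u k

theorem grid_mono {u : ℝ} (hu : 0 < u) : Monotone (grid u) :=
  monotone_nat_of_le_succ fun l => by
    rw [grid_succ]; linarith [grid_pos hu l]

/-- A geometric sum with ratio `1 + δ`; the factor is `(1 + δ) / δ = 3`. -/
theorem sum_grid_le {u : ℝ} (hu : 0 < u) (c : ℕ) : ∑ l ∈ Icc 1 c, grid u l ≤ 3 * grid u c := by
  induction c with
  | zero => simpa using (grid_pos hu 0).le
  | succ c ih =>
    rw [sum_Icc_succ_top (by lia), grid_succ]
    linarith

variable {J P : Type*} {T : J → Type*} [Fintype J] [Fintype P] [Nonempty P] [∀ j, Fintype (T j)]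
  {p : P → Task T → ℝ} {u : ℝ}

theorem sum_le_tmax (hp : ∀ i τ, 0 ≤ p i τ) (s : Finset (Task T)) (q : Task T → P) :
    ∑ τ ∈ s, p (q τ) τ ≤ tmax p := by
  refine (sum_le_sum_of_subset_of_nonneg (subset_univ s) fun τ _ _ => hp _ τ).trans ?_
  exact sum_le_sum fun τ _ => le_sup' (fun i => p i τ) (mem_univ (q τ))

theorem numIntervals_spec (hu : 0 < u) :
    1 ≤ numIntervals p u ∧ tmax p ≤ grid u (numIntervals p u - 1) := by
  refine Nat.sInf_mem (s := {L : ℕ | 1 ≤ L ∧ tmax p ≤ grid u (L - 1)}) ?_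
  obtain ⟨n, hn⟩ := pow_unbounded_of_one_lt (tmax p / u) (show (1 : ℝ) < 1 + δ by norm_num [δ])
  refine ⟨n + 1, by lia, ?_⟩
  rw [div_lt_iff₀ hu] at hn
  simp only [Nat.add_sub_cancel, grid]
  linarith

theorem tmax_le_grid (hu : 0 < u) : tmax p ≤ grid u (numIntervals p u) :=
  (numIntervals_spec hu).2.trans (grid_mono hu (Nat.sub_le _ _))

open Classical in
/-- An integral schedule in which the tasks completed by time `t` on a processor take at most time
`t` gives a feasible solution of the linear program. -/
theorem exists_lpFeasible (hp : ∀ i τ, 0 ≤ p i τ) (hu : IsTimeUnit p u) (q : Task T → P)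
    (F : Task T → ℝ) (D : J → ℝ) (hF : ∀ τ, 0 ≤ F τ)
    (hload : ∀ i t, 0 ≤ t → ∑ τ ∈ univ.filter (fun τ => q τ = i ∧ F τ ≤ t), p i τ ≤ t)
    (hD : ∀ j, 0 ≤ D j) (hFD : ∀ τ, F τ ≤ D τ.1) :
    ∃ y C, LPFeasible p u y C D := by
  set L := numIntervals p u with hL
  have hL1 : 1 ≤ L := (numIntervals_spec hu.1).1
  have hpF : ∀ τ, p (q τ) τ ≤ F τ := fun τ =>
    (single_le_sum (f := fun σ => p (q τ) σ) (fun σ _ => hp _ σ)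
      (show τ ∈ univ.filter (fun σ => q σ = q τ ∧ F σ ≤ F τ) by simp)).trans
      (hload (q τ) (F τ) (hF τ))
  -- Each task goes entirely into the first interval that reaches `F τ`. The schedule may idle past
  -- the horizon, so later tasks are put into interval `L`, where load and pruning hold because
  -- `tmax p ≤ grid u L`.
  have hex : ∀ τ, ∃ l, 1 ≤ l ∧ (F τ ≤ grid u l ∨ l = L) := fun τ => ⟨L, hL1, Or.inr rfl⟩
  let v : Task T → ℕ := fun τ => Nat.find (hex τ)
  have hv1 : ∀ τ, 1 ≤ v τ := fun τ => (Nat.find_spec (hex τ)).1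
  have hv2 : ∀ τ, F τ ≤ grid u (v τ) ∨ v τ = L := fun τ => (Nat.find_spec (hex τ)).2
  have hvL : ∀ τ, v τ ≤ L := fun τ => Nat.find_min' (hex τ) ⟨hL1, Or.inr rfl⟩
  have hvF : ∀ τ, ¬ IsNull p τ → grid u (v τ - 1) ≤ F τ := by
    intro τ hτ
    -- The first interval has left end `grid u 0 = u`, not `0`; this is where processing times of
    -- non-null tasks must be at least the unit.
    rcases (hv1 τ).eq_or_lt with h | h
    · rw [← h, Nat.sub_self, grid_zero]
      exact (hu.2 _ _ ((hp (q τ) τ).lt_of_ne fun h => hτ ⟨q τ, h.symm⟩)).trans (hpF τ)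
    · have := Nat.find_min (hex τ) (m := v τ - 1) (show v τ - 1 < v τ by lia)
      by_contra! hlt
      exact this ⟨by lia, Or.inl hlt.le⟩
  let y : P → Task T → ℕ → ℝ := fun i τ l => if i = q τ ∧ l = v τ then 1 else 0
  have hy : ∀ i τ l, y i τ l = if i = q τ then (if l = v τ then 1 else 0) else 0 := by
    intro i τ l; simp only [y, ite_and]
  have hvm : ∀ τ, v τ ∈ Icc 1 L := fun τ => mem_Icc.2 ⟨hv1 τ, hvL τ⟩
  have hsum : ∀ τ, ∀ g : ℕ → ℝ, ∑ i, ∑ l ∈ Icc 1 L, g l * y i τ l = g (v τ) := by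
    intro τ g
    rw [Finset.sum_eq_single (q τ)]
    · simp only [hy, if_true, mul_ite, mul_one, mul_zero]
      rw [sum_ite_eq', if_pos (hvm τ)]
    · intro i _ hi
      simp [hy, hi]
    · simp
  have hcum : ∀ i τ l, p i τ * ∑ t ∈ Icc 1 l, y i τ t = if q τ = i ∧ v τ ≤ l then p i τ else 0 := by
    intro i τ l
    by_cases hi : i = q τ
    · subst hi
      simp only [hy, if_true, sum_ite_eq', mem_Icc, hv1, true_and]
      split_ifs <;> simp
    · simp [hy, hi, Ne.symm hi]
  refine ⟨y, F, ?_, fun τ _ => hFD τ, hD, ?_, ?_, ?_, ?_⟩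
  · intro τ _
    have := hsum τ (fun _ => 1)
    simp only [one_mul] at this
    exact this.ge
  · intro τ hτ
    rw [hsum τ (fun l => grid u (l - 1))]
    exact hvF τ hτ
  · intro i l hl
    simp only [hcum]
    rw [← sum_filter, filter_filter]
    rcases (mem_Icc.1 hl).2.eq_or_lt with h | h
    · rw [h]
      exact (sum_le_tmax hp _ fun _ => i).trans (tmax_le_grid hu.1)
    · refine le_trans ?_ (hload i (grid u l) (grid_pos hu.1 l).le)
      refine sum_le_sum_of_subset_of_nonneg (fun τ hτ => ?_) fun τ _ _ => hp i τ
      simp only [mem_filter, mem_univ, true_and] at hτ ⊢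
      refine ⟨hτ.2.1, ?_⟩
      rcases hv2 τ with h' | h'
      · exact h'.trans (grid_mono hu.1 hτ.2.2)
      · lia
  · intro i τ _ l hl hlt
    rw [hy]
    split_ifs with h1 h2
    · subst h1 h2
      rcases hv2 τ with h' | h'
      · linarith [hpF τ]
      · rw [h'] at hlt
        have := sum_le_tmax hp {τ} q
        rw [sum_singleton] at this
        linarith [tmax_le_grid (p := p) hu.1]
    · rfl
    · rfl
  · intro i τ _ l _
    rw [hy]; split_ifs <;> norm_num

open Classical in
theorem isClosed_lpFeasible :
    IsClosed {z : (P → Task T → ℕ → ℝ) × (Task T → ℝ) × (J → ℝ) |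
      LPFeasible p u z.1 z.2.1 z.2.2} := by
  have : {z : (P → Task T → ℕ → ℝ) × (Task T → ℝ) × (J → ℝ) |
      LPFeasible p u z.1 z.2.1 z.2.2} = {z |
      (∀ τ, ¬ IsNull p τ → 1 ≤ ∑ i, ∑ l ∈ Icc 1 (numIntervals p u), z.1 i τ l) ∧
      (∀ τ, ¬ IsNull p τ → z.2.1 τ ≤ z.2.2 τ.1) ∧ (∀ j, 0 ≤ z.2.2 j) ∧
      (∀ τ, ¬ IsNull p τ →
        ∑ i, ∑ l ∈ Icc 1 (numIntervals p u), grid u (l - 1) * z.1 i τ l ≤ z.2.1 τ) ∧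
      (∀ i, ∀ l ∈ Icc 1 (numIntervals p u),
        ∑ τ ∈ univ.filter (fun τ => ¬ IsNull p τ), p i τ * ∑ t ∈ Icc 1 l, z.1 i τ t ≤ grid u l) ∧
      (∀ i τ, ¬ IsNull p τ → ∀ l ∈ Icc 1 (numIntervals p u), grid u l < p i τ → z.1 i τ l = 0) ∧
      ∀ i τ, ¬ IsNull p τ → ∀ l ∈ Icc 1 (numIntervals p u), 0 ≤ z.1 i τ l} :=
    Set.ext fun z => ⟨fun ⟨h1, h2, h3, h4, h5, h6, h7⟩ => ⟨h1, h2, h3, h4, h5, h6, h7⟩,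
      fun ⟨h1, h2, h3, h4, h5, h6, h7⟩ => ⟨h1, h2, h3, h4, h5, h6, h7⟩⟩
  rw [this]
  simp only [Set.ofPred_and, Set.ofPred_forall]
  refine IsClosed.inter ?_ <| IsClosed.inter ?_ <| IsClosed.inter ?_ <| IsClosed.inter ?_ <|
    IsClosed.inter ?_ <| IsClosed.inter ?_ ?_
  all_goals
    repeat' refine isClosed_iInter fun _ => ?_
    first
      | exact isClosed_le (by fun_prop) (by fun_prop)
      | exact isClosed_eq (by fun_prop) (by fun_prop)

namespace LPFeasible

variable {y : P → Task T → ℕ → ℝ} {C : Task T → ℝ} {D : J → ℝ}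

theorem sum_nonneg (h : LPFeasible p u y C D) {τ : Task T} (hτ : ¬ IsNull p τ) (g : ℕ → ℝ)
    (hg : ∀ l, 0 ≤ g l) {s : Finset ℕ} (hs : s ⊆ Icc 1 (numIntervals p u)) :
    0 ≤ ∑ i, ∑ l ∈ s, g l * y i τ l :=
  Finset.sum_nonneg fun i _ => Finset.sum_nonneg fun l hl =>
    mul_nonneg (hg l) (h.nonneg i τ hτ l (hs hl))

theorem completion_nonneg (hu : 0 < u) (h : LPFeasible p u y C D) {τ : Task T}
    (hτ : ¬ IsNull p τ) : 0 ≤ C τ :=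
  (h.sum_nonneg hτ (fun l => grid u (l - 1)) (fun _ => (grid_pos hu _).le) subset_rfl).trans
    (h.completion τ hτ)

/-- Every coefficient `grid u (l - 1)` is at least `u`, so bounded completion times bound all
variables; this confines the search for an optimum to a box. -/
theorem le_div (hu : 0 < u) (h : LPFeasible p u y C D) {τ : Task T} (hτ : ¬ IsNull p τ) (i : P)
    {l : ℕ} (hl : l ∈ Icc 1 (numIntervals p u)) : y i τ l ≤ C τ / u := by
  rw [le_div_iff₀ hu]
  refine le_trans ?_ (h.completion τ hτ)
  have h0 : ∀ i, ∀ l ∈ Icc 1 (numIntervals p u), 0 ≤ grid u (l - 1) * y i τ l := fun i l hl =>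
    mul_nonneg (grid_pos hu _).le (h.nonneg i τ hτ l hl)
  calc y i τ l * u ≤ grid u (l - 1) * y i τ l := by
        rw [mul_comm]
        refine mul_le_mul_of_nonneg_right ?_ (h.nonneg i τ hτ l hl)
        simpa [grid_zero] using grid_mono hu (Nat.zero_le (l - 1))
    _ ≤ ∑ l ∈ Icc 1 (numIntervals p u), grid u (l - 1) * y i τ l :=
        single_le_sum (f := fun l => grid u (l - 1) * y i τ l) (h0 i) hl
    _ ≤ _ := single_le_sum (f := fun i => ∑ l ∈ Icc 1 (numIntervals p u), grid u (l - 1) * y i τ l)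
        (fun i _ => Finset.sum_nonneg (h0 i)) (mem_univ i)

open Classical in
-- Values at null tasks and outside the intervals `1, …, L` are unconstrained, so they have to be
-- zeroed before a feasible point can lie in a compact box.
theorem truncate (h : LPFeasible p u y C D) :
    LPFeasible p u
      (fun i τ l => if ¬ IsNull p τ ∧ l ∈ Icc 1 (numIntervals p u) then y i τ l else 0)
      (fun τ => if ¬ IsNull p τ then C τ else 0) D := by
  have key : ∀ τ, ¬ IsNull p τ → ∀ i, ∀ l ∈ Icc 1 (numIntervals p u),
      (if ¬ IsNull p τ ∧ l ∈ Icc 1 (numIntervals p u) then y i τ l else 0) = y i τ l :=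
    fun τ hτ i l hl => if_pos ⟨hτ, hl⟩
  refine ⟨fun τ hτ => ?_, fun τ hτ => ?_, h.job_nonneg, fun τ hτ => ?_, fun i l hl => ?_,
    fun i τ hτ l hl hlt => ?_, fun i τ hτ l hl => ?_⟩
  · rw [sum_congr rfl fun i _ => sum_congr rfl (key τ hτ i)]
    exact h.cover τ hτ
  · rw [if_pos hτ]; exact h.job τ hτ
  · rw [if_pos hτ, sum_congr rfl fun i _ => sum_congr rfl fun l hl => by rw [key τ hτ i l hl]]
    exact h.completion τ hτ
  · refine le_trans (le_of_eq ?_) (h.load i l hl)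
    refine sum_congr rfl fun τ hτ => ?_
    congr 1
    exact sum_congr rfl fun t ht => key τ (mem_filter.1 hτ).2 i t
      (Icc_subset_Icc_right (mem_Icc.1 hl).2 ht)
  · rw [key τ hτ i l hl]; exact h.prune i τ hτ l hl hlt
  · rw [key τ hτ i l hl]; exact h.nonneg i τ hτ l hl

open Classical in
/-- Scaling down a feasible solution such that every task is covered exactly once. -/
theorem normalize (hp : ∀ i τ, 0 ≤ p i τ) (hu : 0 < u) (h : LPFeasible p u y C D) :
    ∃ y' C', LPFeasible p u y' C' D ∧
      (∀ τ, ¬ IsNull p τ → ∑ i, ∑ l ∈ Icc 1 (numIntervals p u), y' i τ l = 1) ∧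
      ∀ τ, ¬ IsNull p τ →
        ∑ i, ∑ l ∈ Icc 1 (numIntervals p u), grid u (l - 1) * y' i τ l = C' τ := by
  set m : Task T → ℝ := fun τ => ∑ i, ∑ l ∈ Icc 1 (numIntervals p u), y i τ l with hm
  have hm1 : ∀ τ, ¬ IsNull p τ → 1 ≤ m τ := h.cover
  have hle : ∀ τ, ¬ IsNull p τ → ∀ i, ∀ l ∈ Icc 1 (numIntervals p u), y i τ l / m τ ≤ y i τ l :=
    fun τ hτ i l hl => div_le_self (h.nonneg i τ hτ l hl) (hm1 τ hτ)
  have hcov : ∀ τ, ¬ IsNull p τ →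
      ∑ i, ∑ l ∈ Icc 1 (numIntervals p u), y i τ l / m τ = 1 := by
    intro τ hτ
    simp only [← sum_div]
    exact div_self (zero_lt_one.trans_le (hm1 τ hτ)).ne'
  have hC : ∀ τ, ¬ IsNull p τ →
      ∑ i, ∑ l ∈ Icc 1 (numIntervals p u), grid u (l - 1) * (y i τ l / m τ) ≤ C τ := fun τ hτ =>
    (sum_le_sum fun i _ => sum_le_sum fun l hl =>
      mul_le_mul_of_nonneg_left (hle τ hτ i l hl) (grid_pos hu _).le).trans (h.completion τ hτ)
  refine ⟨fun i τ l => y i τ l / m τ,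
    fun τ => ∑ i, ∑ l ∈ Icc 1 (numIntervals p u), grid u (l - 1) * (y i τ l / m τ),
    ⟨fun τ hτ => (hcov τ hτ).ge, fun τ hτ => (hC τ hτ).trans (h.job τ hτ), h.job_nonneg,
      fun τ hτ => le_rfl, fun i l hl => ?_, fun i τ hτ l hl hlt => ?_, fun i τ hτ l hl => ?_⟩,
    hcov, fun τ hτ => rfl⟩
  · refine (sum_le_sum fun τ hτ => ?_).trans (h.load i l hl)
    refine mul_le_mul_of_nonneg_left (sum_le_sum fun t ht => ?_) (hp i τ)
    exact hle τ (mem_filter.1 hτ).2 i t (Icc_subset_Icc_right (mem_Icc.1 hl).2 ht)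
  · simp only [h.prune i τ hτ l hl hlt, zero_div]
  · exact div_nonneg (h.nonneg i τ hτ l hl) (zero_le_one.trans (hm1 τ hτ))

end LPFeasible

open Classical in
-- Compactness: positive weights bound `D` once the objective is at most that of a fixed feasible
-- point, `D` bounds `C`, and `C` bounds `y`.
theorem exists_lpOptimal {w : J → ℝ} (hw : ∀ j, 0 < w j) (hp : ∀ i τ, 0 ≤ p i τ)
    (hu : IsTimeUnit p u) : ∃ y C D, LPOptimal w p u y C D := by
  have htmax : 0 ≤ tmax p := by
    simpa using sum_le_tmax hp ∅ fun _ => Classical.arbitrary P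
  -- Reference point: all tasks on one processor, all declared complete at the horizon.
  obtain ⟨y₀, C₀, h₀⟩ := exists_lpFeasible hp hu (fun _ => Classical.arbitrary P)
    (fun _ => tmax p) (fun _ => tmax p) (fun _ => htmax)
    (fun i t ht => by
      by_cases h : tmax p ≤ t
      · exact (sum_le_tmax hp _ fun _ => i).trans h
      · simpa [h] using ht) (fun _ => htmax) (fun _ => le_rfl)
  set V := ∑ j, w j * tmax p with hV
  let b : J → ℝ := fun j => V / w j
  let K : Set ((P → Task T → ℕ → ℝ) × (Task T → ℝ) × (J → ℝ)) :=
    Set.Icc (0, 0, 0) (fun _ τ _ => b τ.1 / u, fun τ => b τ.1, b) ∩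
      {z | LPFeasible p u z.1 z.2.1 z.2.2}
  have hK : IsCompact K := isCompact_Icc.inter_right isClosed_lpFeasible
  have hmem : ∀ y C D, LPFeasible p u y C D → ∑ j, w j * D j ≤ V → ∃ y' C', (y', C', D) ∈ K := by
    intro y C D h hle
    have hD : ∀ j, D j ≤ b j := fun j => by
      rw [le_div_iff₀ (hw j), mul_comm]
      exact (single_le_sum (f := fun j => w j * D j)
        (fun j _ => mul_nonneg (hw j).le (h.job_nonneg j)) (mem_univ j)).trans hle
    have hb : ∀ j, 0 ≤ b j := fun j => (h.job_nonneg j).trans (hD j)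
    refine ⟨_, _, ⟨⟨⟨fun i τ l => ?_, fun τ => ?_, h.job_nonneg⟩,
      ⟨fun i τ l => ?_, fun τ => ?_, hD⟩⟩, h.truncate⟩⟩
    · change 0 ≤ ite _ _ _
      split_ifs with hc
      · exact h.nonneg i τ hc.1 l hc.2
      · exact le_rfl
    · change 0 ≤ ite _ _ _
      split_ifs with hc
      · exact le_rfl
      · exact h.completion_nonneg hu.1 hc
    · change ite _ _ _ ≤ b τ.1 / u
      split_ifs with hc
      · exact (h.le_div hu.1 hc.1 i hc.2).trans
          (div_le_div_of_nonneg_right ((h.job τ hc.1).trans (hD _)) hu.1.le)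
      · exact div_nonneg (hb _) hu.1.le
    · change ite _ _ _ ≤ b τ.1
      split_ifs with hc
      · exact hb _
      · exact (h.job τ hc).trans (hD _)
  obtain ⟨y₁, C₁, h₁⟩ := hmem y₀ C₀ _ h₀ le_rfl
  obtain ⟨z, hz, hmin⟩ := hK.exists_isMinOn ⟨_, h₁⟩
    (f := fun z => ∑ j, w j * z.2.2 j) (by fun_prop)
  refine ⟨z.1, z.2.1, z.2.2, hz.2, fun y C D h => ?_⟩
  by_cases hle : ∑ j, w j * D j ≤ V
  · obtain ⟨y', C', h'⟩ := hmem y C D h hle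
    exact hmin h'
  · exact (hmin h₁).trans (not_le.1 hle).le

/-- There is an optimal solution which covers every task exactly once. -/
theorem exists_lpOptimal_normalized {w : J → ℝ} (hw : ∀ j, 0 < w j) (hp : ∀ i τ, 0 ≤ p i τ)
    (hu : IsTimeUnit p u) : ∃ y C D, LPOptimal w p u y C D ∧
      (∀ τ, ¬ IsNull p τ → ∑ i, ∑ l ∈ Icc 1 (numIntervals p u), y i τ l = 1) ∧
      ∀ τ, ¬ IsNull p τ →
        ∑ i, ∑ l ∈ Icc 1 (numIntervals p u), grid u (l - 1) * y i τ l = C τ := by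
  obtain ⟨y, C, D, h⟩ := exists_lpOptimal hw hp hu
  obtain ⟨y', C', h', h1, h2⟩ := h.feasible.normalize hp hu.1
  exact ⟨y', C', D, ⟨h', h.optimal⟩, h1, h2⟩

end LinearProgram

/-! ### The Shmoys–Tardos rounding. -/

section Rounding

variable {X P : Type*}

/-- Tasks can be matched to slots which contain a positive part of them. -/
theorem exists_slot_matching [Fintype P] (s : Finset X) (r : P → X → ℕ) (x : P → X → ℝ)
    (hr : ∀ i, Function.Injective (r i)) (hx : ∀ i, ∀ τ ∈ s, 0 ≤ x i τ)
    (hsum : ∀ τ ∈ s, ∑ i, x i τ = 1) :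
    ∃ g : s → P × ℕ, Function.Injective g ∧ ∀ τ : s, 0 < x (g τ).1 τ ∧
      offset s (r (g τ).1) (x (g τ).1) τ < (g τ).2 + 1 ∧
      ((g τ).2 : ℝ) < offset s (r (g τ).1) (x (g τ).1) τ + x (g τ).1 τ := by
  classical
  -- A bound on the usable slots, needed only to make the neighbourhoods finite.
  let N : X → ℕ := fun τ => univ.sup fun i => ⌈offset s (r i) (x i) τ + x i τ⌉₊
  let t : s → Finset (P × ℕ) := fun τ => (univ ×ˢ range (N τ)).filter fun q =>
    0 < x q.1 τ ∧ offset s (r q.1) (x q.1) τ < q.2 + 1 ∧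
      (q.2 : ℝ) < offset s (r q.1) (x q.1) τ + x q.1 τ
  have ht : ∀ (τ : s) (q : P × ℕ), q ∈ t τ ↔ 0 < x q.1 τ ∧
      offset s (r q.1) (x q.1) τ < q.2 + 1 ∧
      (q.2 : ℝ) < offset s (r q.1) (x q.1) τ + x q.1 τ := by
    intro τ q
    simp only [t, mem_filter, mem_product, mem_univ, true_and, mem_range, and_iff_right_iff_imp]
    rintro ⟨-, -, h⟩
    exact (Nat.lt_ceil.2 h).trans_le
      (le_sup (f := fun i => ⌈offset s (r i) (x i) τ + x i τ⌉₊) (mem_univ q.1))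
  -- Hall's condition. The fractions of the tasks in `A` total `#A`; on each processor their
  -- disjoint pieces are covered by the unit slots adjacent to `A`, so they are no longer than the
  -- number of these slots.
  suffices h : ∀ A : Finset s, #A ≤ #(A.biUnion t) by
    obtain ⟨g, hg, hgt⟩ := (all_card_le_biUnion_card_iff_exists_injective t).1 h
    exact ⟨g, hg, fun τ => (ht τ _).1 (hgt τ)⟩
  intro A
  have hfib : ∀ i, ∑ τ ∈ A, x i τ ≤ #((A.biUnion t).filter fun q => q.1 = i) := by
    intro i
    have := sum_le_sum_of_Ico_cover A ((A.biUnion t).filter fun q => q.1 = i)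
      (fun τ => offset s (r i) (x i) τ) (fun τ => x i τ) (fun q => (q.2 : ℝ)) (fun _ => 1)
      (fun τ _ => hx i τ τ.2) (fun _ _ => zero_le_one)
      (fun τ _ τ' _ h => offset_disjoint (hr i) (hx i) τ.2 τ'.2 (Subtype.coe_injective.ne h))
      (fun τ hτ v h1 h2 => ?_)
    · simpa using this
    · have hv : 0 ≤ v := (offset_nonneg (hx i) τ).trans h1
      refine ⟨(i, ⌊v⌋₊), ?_, Nat.floor_le hv, Nat.lt_floor_add_one v⟩
      simp only [mem_filter, mem_biUnion, and_true]
      refine ⟨τ, hτ, (ht _ _).2 ⟨by simp only; linarith, ?_, ?_⟩⟩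
      · exact h1.trans_lt (Nat.lt_floor_add_one v)
      · exact (Nat.floor_le hv).trans_lt h2
  have : (#A : ℝ) ≤ #(A.biUnion t) := by
    calc (#A : ℝ) = ∑ τ ∈ A, ∑ i, x i τ := by
          have h : ∀ τ : s, ∑ i, x i τ = 1 := fun τ => hsum τ τ.2
          simp [h]
      _ = ∑ i, ∑ τ ∈ A, x i τ := sum_comm
      _ ≤ ∑ i, (#((A.biUnion t).filter fun q => q.1 = i) : ℝ) := sum_le_sum fun i _ => hfib i
      _ = #(A.biUnion t) := by
          rw [card_eq_sum_card_fiberwise (f := Prod.fst) (t := univ) fun _ _ => by simp]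
          push_cast; rfl
  exact_mod_cast this

open MeasureTheory in
/-- Shmoys–Tardos: the tasks matched to the slots of a processor take, up to one task, no more time
than the fractional load of the processor. -/
theorem sum_matched_le (s B : Finset X) (hB : B ⊆ s) (r slot : X → ℕ) (x q : X → ℝ) (G : ℝ)
    (hr : Function.Injective r) (hx : ∀ τ ∈ s, 0 ≤ x τ) (hq : ∀ τ ∈ s, 0 ≤ q τ)
    (hsorted : ∀ τ ∈ s, ∀ τ' ∈ s, r τ < r τ' → q τ' ≤ q τ)
    (hslot : ∀ τ ∈ B, ∀ τ' ∈ B, slot τ = slot τ' → τ = τ')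
    (hend : ∀ τ ∈ B, (slot τ : ℝ) < offset s r x τ + x τ) (hG : 0 ≤ G) (hqG : ∀ τ ∈ B, q τ ≤ G) :
    ∑ τ ∈ B, q τ ≤ ∑ τ ∈ s, q τ * x τ + G := by
  classical
  let I : X → Set ℝ := fun σ => Set.Ico (offset s r x σ) (offset s r x σ + x σ)
  let K : X → Set ℝ := fun τ => Set.Ico ((slot τ : ℝ) - 1) (slot τ)
  let o : X → X → ℝ := fun τ σ => volume.real (K τ ∩ I σ)
  have hfin : ∀ τ σ, volume (K τ ∩ I σ) ≠ ⊤ := fun τ σ =>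
    measure_ne_top_of_subset Set.inter_subset_left measure_Ico_lt_top.ne
  have hle : ∀ τ ∈ s, ∀ σ ∈ s, r σ ≤ r τ → q τ ≤ q σ := fun τ hτ σ hσ h =>
    h.eq_or_lt.elim (fun h => (congrArg q (hr h)).ge) fun h => hsorted σ hσ τ hτ h
  -- A task is charged to the slot preceding its own. That slot is filled by pieces up to that of
  -- `τ` in the sorted order, all of tasks at least as long, so the fractional load in it is at
  -- least `q τ`.
  have hcover : ∀ τ ∈ B, 1 ≤ slot τ → q τ ≤ ∑ σ ∈ s, q σ * o τ σ := by
    intro τ hτ h1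
    have hsub : K τ ⊆ ⋃ σ ∈ s.filter (fun σ => r σ ≤ r τ), K τ ∩ I σ := by
      intro v hv
      have h1' : (1 : ℝ) ≤ slot τ := by exact_mod_cast h1
      obtain ⟨σ, hσ, h⟩ := exists_offset_le hr (hB hτ) (v := v) (by linarith [hv.1])
        (hv.2.trans (hend τ hτ))
      exact Set.mem_iUnion₂.2 ⟨σ, mem_filter.2 ⟨hσ, h.1⟩, hv, h.2⟩
    have h2 : 1 ≤ ∑ σ ∈ s.filter (fun σ => r σ ≤ r τ), o τ σ := by
      have := (measureReal_mono hsub (measure_biUnion_lt_top (finite_toSet _)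
        fun σ _ => (hfin τ σ).lt_top).ne).trans (measureReal_biUnion_finset_le (μ := volume) _ _)
      simpa [K, o] using this
    calc q τ ≤ ∑ σ ∈ s.filter (fun σ => r σ ≤ r τ), q τ * o τ σ := by
          rw [← mul_sum]; exact le_mul_of_one_le_right (hq τ (hB hτ)) h2
      _ ≤ ∑ σ ∈ s.filter (fun σ => r σ ≤ r τ), q σ * o τ σ := sum_le_sum fun σ hσ =>
          mul_le_mul_of_nonneg_right (hle τ (hB hτ) σ (mem_filter.1 hσ).1 (mem_filter.1 hσ).2)
            measureReal_nonneg
      _ ≤ _ := sum_le_sum_of_subset_of_nonneg (filter_subset _ _) fun σ hσ _ =>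
          mul_nonneg (hq σ hσ) measureReal_nonneg
  -- Distinct tasks are charged to disjoint slots, so no part of a piece is used twice.
  have hpack : ∀ σ ∈ s, ∑ τ ∈ B, o τ σ ≤ x σ := by
    intro σ hσ
    have hdisj : ∀ τ ∈ B, ∀ τ' ∈ B, τ ≠ τ' → Disjoint (K τ) (K τ') := by
      intro τ hτ τ' hτ' hne
      rw [Set.disjoint_left]
      rintro v ⟨h1, h2⟩ ⟨h3, h4⟩
      refine hne (hslot τ hτ τ' hτ' ?_)
      have h5 : (slot τ : ℝ) < slot τ' + 1 := by linarith
      have h6 : (slot τ' : ℝ) < slot τ + 1 := by linarith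
      have h5' : slot τ < slot τ' + 1 := by exact_mod_cast h5
      have h6' : slot τ' < slot τ + 1 := by exact_mod_cast h6
      lia
    rw [← measureReal_biUnion_finset (fun τ hτ τ' hτ' h =>
      (hdisj τ hτ τ' hτ' h).mono Set.inter_subset_left Set.inter_subset_left)
      (fun τ _ => measurableSet_Ico.inter measurableSet_Ico) (fun τ _ => hfin τ σ)]
    refine (measureReal_mono (Set.iUnion₂_subset fun τ _ => Set.inter_subset_right)
      measure_Ico_lt_top.ne).trans ?_
    simp [hx σ hσ]
  -- Slot `0` has no predecessor; its single task is the extra term `G`.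
  have hfirst : ∑ τ ∈ B.filter (fun τ => ¬ 1 ≤ slot τ), q τ ≤ G := by
    rcases (B.filter fun τ => ¬ 1 ≤ slot τ).eq_empty_or_nonempty with h | ⟨τ, hτ⟩
    · rw [h, sum_empty]; exact hG
    · have : B.filter (fun τ => ¬ 1 ≤ slot τ) = {τ} := by
        rw [eq_singleton_iff_unique_mem]
        refine ⟨hτ, fun τ' hτ' => ?_⟩
        simp only [mem_filter] at hτ hτ'
        exact hslot _ hτ'.1 _ hτ.1 (by lia)
      rw [this, sum_singleton]
      exact hqG τ (mem_filter.1 hτ).1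
  rw [← sum_filter_add_sum_filter_not B (fun τ => 1 ≤ slot τ)]
  refine add_le_add ?_ hfirst
  calc ∑ τ ∈ B.filter (fun τ => 1 ≤ slot τ), q τ
      ≤ ∑ τ ∈ B.filter (fun τ => 1 ≤ slot τ), ∑ σ ∈ s, q σ * o τ σ :=
        sum_le_sum fun τ hτ => hcover τ (mem_filter.1 hτ).1 (mem_filter.1 hτ).2
    _ ≤ ∑ τ ∈ B, ∑ σ ∈ s, q σ * o τ σ :=
        sum_le_sum_of_subset_of_nonneg (filter_subset _ _) fun τ _ _ =>
          sum_nonneg fun σ hσ => mul_nonneg (hq σ hσ) measureReal_nonneg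
    _ = ∑ σ ∈ s, q σ * ∑ τ ∈ B, o τ σ := by rw [sum_comm]; simp only [mul_sum]
    _ ≤ _ := sum_le_sum fun σ hσ => mul_le_mul_of_nonneg_left (hpack σ hσ) (hq σ hσ)

end Rounding

/-! ### TaskScheduling on one stage: existence of runs and the bound `27 / 2`. -/

section StageRun

variable {J P : Type*} {T : J → Type*} [Fintype J] [Fintype P] [∀ j, Fintype (T j)]
  {w : J → ℝ} {p : P → Task T → ℝ} {u : ℝ}

open Classical in
-- Each class is matched by Hall's theorem. `hcls` keeps null tasks out of the classes of the
-- others, so that the offsets in `IsRounding`, which sum over whole classes, see non-null tasks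
-- only.
theorem exists_isRounding (cls : Task T → ℕ) (x : P → Task T → ℝ)
    (hcls : ∀ τ τ', cls τ = cls τ' → IsNull p τ → IsNull p τ')
    (hx : ∀ i τ, ¬ IsNull p τ → 0 ≤ x i τ) (hsum : ∀ τ, ¬ IsNull p τ → ∑ i, x i τ = 1) :
    ∃ proc rank slot, IsRounding p cls x rank slot proc ∧
      ∀ τ, IsNull p τ → p (proc τ) τ = 0 := by
  choose r hr hsorted using fun i => exists_sorting fun τ => - p i τ
  let s : ℕ → Finset (Task T) := fun c => univ.filter fun τ => cls τ = c ∧ ¬ IsNull p τ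
  have hs : ∀ {c τ}, τ ∈ s c → ¬ IsNull p τ := fun h => (mem_filter.1 h).2.2
  choose g hg hgs using fun c => exists_slot_matching (s c) r x hr
    (fun i τ hτ => hx i τ (hs hτ)) (fun τ hτ => hsum τ (hs hτ))
  have hmem : ∀ τ, ¬ IsNull p τ → τ ∈ s (cls τ) := fun τ hτ => by simp [s, hτ]
  let proc : Task T → P := fun τ =>
    if h : IsNull p τ then h.choose else (g (cls τ) ⟨τ, hmem τ h⟩).1
  let slot : Task T → ℕ := fun τ =>
    if h : IsNull p τ then 0 else (g (cls τ) ⟨τ, hmem τ h⟩).2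
  have hproc : ∀ τ (h : ¬ IsNull p τ), proc τ = (g (cls τ) ⟨τ, hmem τ h⟩).1 :=
    fun τ h => dif_neg h
  have hslot : ∀ τ (h : ¬ IsNull p τ), slot τ = (g (cls τ) ⟨τ, hmem τ h⟩).2 :=
    fun τ h => dif_neg h
  have hoff : ∀ i τ, ¬ IsNull p τ → offset (s (cls τ)) (r i) (x i) τ =
      ∑ τ' ∈ univ.filter (fun τ' => cls τ' = cls τ ∧ r i τ' < r i τ), x i τ' := by
    intro i τ hτ
    rw [offset, filter_filter]
    congr 1
    ext τ'
    simp only [mem_filter, mem_univ, true_and]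
    exact ⟨fun h => ⟨h.1.1, h.2⟩, fun h => ⟨⟨h.1, fun h' => hτ (hcls _ _ h.1 h')⟩, h.2⟩⟩
  refine ⟨proc, r, slot, ⟨hr, fun i τ τ' _ h => neg_le_neg_iff.1 (hsorted i τ τ' h),
    fun τ hτ => ?_, fun τ hτ => ?_, fun τ hτ => ?_, fun τ τ' hτ hτ' hc hp hl => ?_⟩,
    fun τ hτ => ?_⟩
  · rw [hproc τ hτ]
    exact (hgs (cls τ) ⟨τ, hmem τ hτ⟩).1
  · rw [← hoff _ τ hτ, hproc τ hτ, hslot τ hτ]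
    exact (hgs (cls τ) ⟨τ, hmem τ hτ⟩).2.1
  · rw [← hoff _ τ hτ, hproc τ hτ, hslot τ hτ]
    exact (hgs (cls τ) ⟨τ, hmem τ hτ⟩).2.2
  · have hmem' : τ' ∈ s (cls τ) := hc ▸ hmem τ' hτ'
    have h : ∀ c (h1 : τ' ∈ s c) (h2 : τ' ∈ s (cls τ')), cls τ' = c →
        g (cls τ') ⟨τ', h2⟩ = g c ⟨τ', h1⟩ := by
      rintro _ _ _ rfl; rfl
    rw [hproc τ hτ, hproc τ' hτ', h _ hmem' _ hc.symm] at hp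
    rw [hslot τ hτ, hslot τ' hτ', h _ hmem' _ hc.symm] at hl
    exact congrArg Subtype.val (hg (cls τ) (Prod.ext hp hl))
  · simp only [proc, dif_pos hτ]
    exact hτ.choose_spec

variable [Nonempty P]

theorem a_div : a / (a - 1) = 3 := by norm_num [a]

open Classical in
-- A normalized optimum is used because there `C` is a true average of left end points: it lies
-- between `u` and `grid u (L - 1)`, which makes a class in `1, …, L` available to every non-null
-- task.
theorem nonempty_taskSchedulingRun (hw : ∀ j, 0 < w j) (hp : ∀ i τ, 0 ≤ p i τ)
    (hu : IsTimeUnit p u) : Nonempty (TaskSchedulingRun w p u) := by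
  obtain ⟨y, C, D, hopt, hcov, hC⟩ := exists_lpOptimal_normalized hw hp hu
  set L := numIntervals p u with hLdef
  have hL1 : 1 ≤ L := (numIntervals_spec hu.1).1
  have hmass : ∀ τ, ¬ IsNull p τ → ∀ g : ℝ,
      ∑ i, ∑ l ∈ Icc 1 L, g * y i τ l = g := by
    intro τ hτ g
    simp only [← mul_sum]
    rw [hcov τ hτ, mul_one]
  have hCu : ∀ τ, ¬ IsNull p τ → u ≤ C τ := by
    intro τ hτ
    refine (hmass τ hτ u).ge.trans ?_
    rw [← hC τ hτ]
    refine sum_le_sum fun i _ => sum_le_sum fun l hl =>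
      mul_le_mul_of_nonneg_right ?_ (hopt.feasible.nonneg i τ hτ l hl)
    simpa [grid_zero] using grid_mono hu.1 (Nat.zero_le (l - 1))
  have hCL : ∀ τ, ¬ IsNull p τ → a * C τ ≤ grid u L := by
    intro τ hτ
    have : C τ ≤ grid u (L - 1) := by
      rw [← hC τ hτ, ← hmass τ hτ (grid u (L - 1))]
      refine sum_le_sum fun i _ => sum_le_sum fun l hl =>
        mul_le_mul_of_nonneg_right ?_ (hopt.feasible.nonneg i τ hτ l hl)
      exact grid_mono hu.1 (Nat.sub_le_sub_right (mem_Icc.1 hl).2 1)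
    rw [grid_eq_mul_grid_pred u hL1, a]
    linarith
  have hex : ∀ τ, ∃ l, IsNull p τ ∨ a * C τ ≤ grid u l := fun τ =>
    ⟨L, or_iff_not_imp_left.2 (hCL τ)⟩
  let cls : Task T → ℕ := fun τ => Nat.find (hex τ)
  have cls_null : ∀ τ, IsNull p τ → cls τ = 0 := fun τ hτ =>
    (Nat.find_eq_zero (hex τ)).2 (Or.inl hτ)
  have cls_upper : ∀ τ, ¬ IsNull p τ → a * C τ ≤ grid u (cls τ) := fun τ hτ =>
    (Nat.find_spec (hex τ)).resolve_left hτ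
  have cls_pos : ∀ τ, ¬ IsNull p τ → 1 ≤ cls τ := by
    intro τ hτ
    by_contra! h
    have h0 : cls τ = 0 := by lia
    have h1 := cls_upper τ hτ
    rw [h0, grid_zero, a] at h1
    linarith [hCu τ hτ, hu.1]
  have cls_le : ∀ τ, ¬ IsNull p τ → cls τ ≤ L := fun τ hτ =>
    Nat.find_min' (hex τ) (Or.inr (hCL τ hτ))
  have cls_lower : ∀ τ, ¬ IsNull p τ → grid u (cls τ - 1) ≤ a * C τ := by
    intro τ hτ
    have hlt : cls τ - 1 < Nat.find (hex τ) := by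
      have := cls_pos τ hτ
      change cls τ - 1 < cls τ
      lia
    exact (not_le.1 (not_or.1 (Nat.find_min (hex τ) hlt)).2).le
  let z : P → Task T → ℝ := fun i τ => ∑ t ∈ Icc 1 (cls τ), a / (a - 1) * y i τ t
  have hsub : ∀ τ, ¬ IsNull p τ → Icc 1 (cls τ) ⊆ Icc 1 L := fun τ hτ =>
    Icc_subset_Icc_right (cls_le τ hτ)
  have hz : ∀ i τ, ¬ IsNull p τ → 0 ≤ z i τ := fun i τ hτ => sum_nonneg fun t ht =>
    mul_nonneg (by rw [a_div]; norm_num) (hopt.feasible.nonneg i τ hτ t (hsub τ hτ ht))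
  -- Markov's inequality: mass after interval `cls τ` has left end points at least `a * C τ`, so it
  -- is at most `1 / a`. The mass `1 - 1 / a` that remains is scaled by `a / (a - 1)` to at least
  -- one.
  have hz1 : ∀ τ, ¬ IsNull p τ → 1 ≤ ∑ i, z i τ := by
    intro τ hτ
    simp only [z, a_div, ← mul_sum]
    set m := ∑ i, ∑ t ∈ Icc 1 (cls τ), y i τ t with hm
    have hm' : m = ∑ i, ∑ l ∈ Icc 1 L, if l ≤ cls τ then y i τ l else 0 := by
      refine sum_congr rfl fun i _ => ?_
      rw [← sum_filter]
      refine sum_congr ?_ fun _ _ => rfl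
      ext l
      simp only [mem_Icc, mem_filter]
      have := cls_le τ hτ
      lia
    have hle : grid u (cls τ) * (1 - m) ≤ C τ := by
      rw [← hC τ hτ, ← hcov τ hτ, hm', ← sum_sub_distrib, mul_sum]
      refine sum_le_sum fun i _ => ?_
      rw [← sum_sub_distrib, mul_sum]
      refine sum_le_sum fun l hl => ?_
      have hy := hopt.feasible.nonneg i τ hτ l hl
      split_ifs with h
      · rw [sub_self, mul_zero]
        exact mul_nonneg (grid_pos hu.1 _).le hy
      · rw [sub_zero]
        exact mul_le_mul_of_nonneg_right (grid_mono hu.1 (by lia)) hy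
    have h1 := cls_upper τ hτ
    have h2 := hCu τ hτ
    have h3 := hu.1
    rw [a] at h1
    by_contra! hlt
    nlinarith
  let x : P → Task T → ℝ := fun i τ => z i τ / ∑ i, z i τ
  have hx : ∀ i τ, ¬ IsNull p τ → 0 ≤ x i τ := fun i τ hτ =>
    div_nonneg (hz i τ hτ) (zero_le_one.trans (hz1 τ hτ))
  have hxsum : ∀ τ, ¬ IsNull p τ → ∑ i, x i τ = 1 := by
    intro τ hτ
    simp only [x, ← sum_div]
    exact div_self (zero_lt_one.trans_le (hz1 τ hτ)).ne'
  have hcls : ∀ τ τ', cls τ = cls τ' → IsNull p τ → IsNull p τ' := by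
    intro τ τ' h hτ
    by_contra hτ'
    have := cls_pos τ' hτ'
    have := cls_null τ hτ
    lia
  obtain ⟨proc, rank, slot, hround, hnull⟩ := exists_isRounding cls x hcls hx hxsum
  obtain ⟨pos, hpos, hposc⟩ := exists_sorting cls
  exact ⟨{
    y := y, C := C, D := D, optimal := hopt, cls := cls, cls_null := cls_null
    cls_mem := fun τ hτ => mem_Icc.2 ⟨cls_pos τ hτ, cls_le τ hτ⟩
    cls_lower := cls_lower, cls_upper := cls_upper, x := x, x_nonneg := hx
    x_le := fun i τ hτ => div_le_self (hz i τ hτ) (hz1 τ hτ)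
    x_sum := hxsum, proc := proc, rank := rank, slot := slot, rounding := hround
    proc_null := hnull, pos := pos, pos_injective := hpos
    pos_cls := fun τ τ' h => by
      rcases lt_trichotomy (pos τ) (pos τ') with h' | h' | h'
      · exact h'
      · exact absurd h (by rw [hpos h']; exact lt_irrefl _)
      · exact absurd (hposc _ _ h') (not_le.2 h) }⟩

namespace TaskSchedulingRun

open Classical in
-- The extra task of the rounding has length at most `grid u c`: a positive fraction comes from some
-- interval up to `c`, and pruning excludes longer tasks there.
theorem class_load (hp : ∀ i τ, 0 ≤ p i τ) (hu : IsTimeUnit p u) (A : TaskSchedulingRun w p u)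
    (i : P) {c : ℕ} (hc : 1 ≤ c) :
    ∑ τ ∈ univ.filter (fun τ => A.proc τ = i ∧ A.cls τ = c), p i τ ≤
      ∑ τ ∈ univ.filter (fun τ => A.cls τ = c), p i τ * A.x i τ + grid u c := by
  have hnull : ∀ τ, A.cls τ = c → ¬ IsNull p τ := fun τ h h' => by
    have := A.cls_null τ h'
    lia
  refine sum_matched_le _ _ (fun τ hτ => ?_) (A.rank i) A.slot (A.x i) (p i) _
    (A.rounding.rank_injective i) (fun τ hτ => A.x_nonneg i τ (hnull τ (mem_filter.1 hτ).2))
    (fun τ _ => hp i τ) (fun τ hτ τ' hτ' h => ?_) (fun τ hτ τ' hτ' h => ?_) (fun τ hτ => ?_)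
    (grid_pos hu.1 c).le (fun τ hτ => ?_)
  · simp only [mem_filter] at hτ ⊢
    exact ⟨hτ.1, hτ.2.2⟩
  · exact A.rounding.sorted i τ τ' (((mem_filter.1 hτ).2).trans (mem_filter.1 hτ').2.symm) h
  · simp only [mem_filter, mem_univ, true_and] at hτ hτ'
    exact A.rounding.matching τ τ' (hnull τ hτ.2) (hnull τ' hτ'.2) (hτ.2.trans hτ'.2.symm)
      (hτ.1.trans hτ'.1.symm) h
  · simp only [mem_filter, mem_univ, true_and] at hτ
    have := A.rounding.ends τ (hnull τ hτ.2)
    rw [hτ.1, hτ.2] at this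
    rwa [offset, filter_filter]
  · simp only [mem_filter, mem_univ, true_and] at hτ
    obtain ⟨h1, rfl⟩ := hτ
    have hn := hnull τ rfl
    have hx := A.rounding.support τ hn
    rw [h1] at hx
    by_contra! hlt
    refine hx.not_ge ((A.x_le i τ hn).trans (sum_nonpos fun t ht => ?_))
    have hcL := (mem_Icc.1 (A.cls_mem τ hn)).2
    rw [mem_Icc] at ht
    rw [A.optimal.feasible.prune i τ hn t (mem_Icc.2 ⟨ht.1, ht.2.trans hcL⟩)
      ((grid_mono hu.1 ht.2).trans_lt hlt), mul_zero]

open Classical in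
theorem start_add (A : TaskSchedulingRun w p u) (τ : Task T) :
    A.start τ + p (A.proc τ) τ =
      ∑ τ' ∈ univ.filter (fun τ' => A.proc τ' = A.proc τ ∧ A.pos τ' ≤ A.pos τ),
        p (A.proc τ) τ' := by
  have := offset_add (s := univ.filter fun τ' => A.proc τ' = A.proc τ) (x := p (A.proc τ))
    A.pos_injective (τ := τ) (by simp)
  rw [start]
  simpa only [offset, filter_filter] using this

theorem start_nonneg (hp : ∀ i τ, 0 ≤ p i τ) (A : TaskSchedulingRun w p u) (τ : Task T) :
    0 ≤ A.start τ := sum_nonneg fun _ _ => hp _ _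

theorem start_add_le (hp : ∀ i τ, 0 ≤ p i τ) (A : TaskSchedulingRun w p u) {τ τ' : Task T}
    (hproc : A.proc τ = A.proc τ') (h : A.pos τ < A.pos τ') :
    A.start τ + p (A.proc τ) τ ≤ A.start τ' := by
  classical
  rw [start_add, hproc, start]
  refine sum_le_sum_of_subset_of_nonneg (fun σ hσ => ?_) fun _ _ _ => hp _ _
  simp only [mem_filter, mem_univ, true_and] at hσ ⊢
  exact ⟨hσ.1, by lia⟩

theorem sequential (hp : ∀ i τ, 0 ≤ p i τ) (A : TaskSchedulingRun w p u) {τ τ' : Task T}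
    (hne : τ ≠ τ') (hproc : A.proc τ = A.proc τ') :
    A.start τ + p (A.proc τ) τ ≤ A.start τ' ∨ A.start τ' + p (A.proc τ') τ' ≤ A.start τ :=
  (lt_or_gt_of_ne (A.pos_injective.ne hne)).imp (A.start_add_le hp hproc)
    (A.start_add_le hp hproc.symm)

/-- Every task completes within `27 / 2` times the completion time of its job in the linear
program. -/
theorem start_add_le_mul (hp : ∀ i τ, 0 ≤ p i τ) (hu : IsTimeUnit p u)
    (A : TaskSchedulingRun w p u) (τ : Task T) :
    A.start τ + p (A.proc τ) τ ≤ 27 / 2 * A.D τ.1 := by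
  classical
  set i := A.proc τ
  set c := A.cls τ with hc
  have hposcls : ∀ σ, A.pos σ ≤ A.pos τ → A.cls σ ≤ c := fun σ h => by
    by_contra! hlt
    exact h.not_gt (A.pos_cls _ _ hlt)
  -- Class `0` consists of null tasks, which take no time where they are placed.
  have h1 : A.start τ + p i τ ≤
      ∑ σ ∈ univ.filter (fun σ => A.proc σ = i ∧ A.cls σ ∈ Icc 1 c), p i σ := by
    rw [start_add, ← sum_filter_add_sum_filter_not _ (fun σ => A.cls σ = 0),
      sum_eq_zero (s := filter (fun σ => A.cls σ = 0) _), zero_add]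
    · refine sum_le_sum_of_subset_of_nonneg (fun σ hσ => ?_) fun _ _ _ => hp _ _
      simp only [mem_filter, mem_univ, true_and, mem_Icc] at hσ ⊢
      exact ⟨hσ.1.1, by lia, hposcls σ hσ.1.2⟩
    · intro σ hσ
      simp only [mem_filter, mem_univ, true_and] at hσ
      have hnull : IsNull p σ := by
        by_contra h
        have := (mem_Icc.1 (A.cls_mem σ h)).1
        lia
      rw [← hσ.1.1]
      exact A.proc_null σ hnull
  by_cases hτ : IsNull p τ
  · have h0 : c = 0 := A.cls_null τ hτ
    rw [h0] at h1
    refine h1.trans (le_trans (by simp) (mul_nonneg (by norm_num) (A.optimal.feasible.job_nonneg _)))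
  have hcm := mem_Icc.1 (A.cls_mem τ hτ)
  have hnn : ∀ σ, A.cls σ ∈ Icc 1 c → ¬ IsNull p σ := fun σ h h' => by
    rw [A.cls_null σ h'] at h
    simp at h
  have h2 : ∑ σ ∈ univ.filter (fun σ => A.proc σ = i ∧ A.cls σ ∈ Icc 1 c), p i σ ≤
      ∑ σ ∈ univ.filter (fun σ => A.cls σ ∈ Icc 1 c), p i σ * A.x i σ +
        ∑ l ∈ Icc 1 c, grid u l := by
    rw [← sum_fiberwise_of_maps_to (s := univ.filter fun σ => A.proc σ = i ∧ A.cls σ ∈ Icc 1 c)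
        (t := Icc 1 c) (g := A.cls) (fun σ hσ => (mem_filter.1 hσ).2.2),
      ← sum_fiberwise_of_maps_to (s := univ.filter fun σ => A.cls σ ∈ Icc 1 c)
        (t := Icc 1 c) (g := A.cls) (fun σ hσ => (mem_filter.1 hσ).2), ← sum_add_distrib]
    refine sum_le_sum fun l hl => ?_
    have e1 : (univ.filter fun σ => A.proc σ = i ∧ A.cls σ ∈ Icc 1 c).filter
        (fun σ => A.cls σ = l) = univ.filter fun σ => A.proc σ = i ∧ A.cls σ = l := by
      ext σ
      simp only [mem_filter, mem_univ, true_and]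
      exact ⟨fun h => ⟨h.1.1, h.2⟩, fun h => ⟨⟨h.1, h.2 ▸ hl⟩, h.2⟩⟩
    have e2 : (univ.filter fun σ => A.cls σ ∈ Icc 1 c).filter
        (fun σ => A.cls σ = l) = univ.filter fun σ => A.cls σ = l := by
      ext σ
      simp only [mem_filter, mem_univ, true_and]
      exact ⟨fun h => h.2, fun h => ⟨h ▸ hl, h⟩⟩
    rw [e1, e2]
    exact A.class_load hp hu i (mem_Icc.1 hl).1
  have h3 : ∑ σ ∈ univ.filter (fun σ => A.cls σ ∈ Icc 1 c), p i σ * A.x i σ ≤ 3 * grid u c := by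
    refine le_trans ?_ (mul_le_mul_of_nonneg_left
      (A.optimal.feasible.load i c (A.cls_mem τ hτ)) (by norm_num))
    have hy : ∀ σ, ¬ IsNull p σ → ∀ t ∈ Icc 1 c, 0 ≤ A.y i σ t := fun σ hσ t ht =>
      A.optimal.feasible.nonneg i σ hσ t (Icc_subset_Icc_right hcm.2 ht)
    rw [mul_sum]
    calc ∑ σ ∈ univ.filter (fun σ => A.cls σ ∈ Icc 1 c), p i σ * A.x i σ
        ≤ ∑ σ ∈ univ.filter (fun σ => A.cls σ ∈ Icc 1 c),
            3 * (p i σ * ∑ t ∈ Icc 1 c, A.y i σ t) := by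
          refine sum_le_sum fun σ hσ => ?_
          have hσ' := (mem_filter.1 hσ).2
          have := A.x_le i σ (hnn σ hσ')
          rw [a_div, ← mul_sum] at this
          rw [mul_left_comm]
          refine mul_le_mul_of_nonneg_left (this.trans ?_) (hp i σ)
          refine mul_le_mul_of_nonneg_left ?_ (by norm_num)
          exact sum_le_sum_of_subset_of_nonneg (Icc_subset_Icc_right (mem_Icc.1 hσ').2)
            fun t ht _ => hy σ (hnn σ hσ') t ht
      _ ≤ _ := by
          refine sum_le_sum_of_subset_of_nonneg (fun σ hσ => ?_) fun σ hσ _ => ?_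
          · simp only [mem_filter, mem_univ, true_and] at hσ ⊢
            exact hnn σ hσ
          · exact mul_nonneg (by norm_num) (mul_nonneg (hp i σ)
              (sum_nonneg (hy σ (mem_filter.1 hσ).2)))
  have h4 := sum_grid_le hu.1 c
  have h5 := grid_eq_mul_grid_pred u hcm.1
  have h6 := A.cls_lower τ hτ
  have h7 := A.optimal.feasible.job τ hτ
  rw [a, ← hc] at h6
  -- `(3 + 3) * (3 / 2) * (3 / 2) = 27 / 2`: rounded load, one grid step back, and the factor `a`.
  linarith

variable [∀ j, Nonempty (T j)]

theorem le_jobCompletion (A : TaskSchedulingRun w p u) (τ : Task T) :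
    A.start τ + p (A.proc τ) τ ≤ A.jobCompletion τ.1 :=
  le_sup' (fun k : T τ.1 => A.start ⟨τ.1, k⟩ + p (A.proc ⟨τ.1, k⟩) ⟨τ.1, k⟩) (mem_univ τ.2)

theorem jobCompletion_nonneg (hp : ∀ i τ, 0 ≤ p i τ) (A : TaskSchedulingRun w p u) (j : J) :
    0 ≤ A.jobCompletion j :=
  (add_nonneg (A.start_nonneg hp _) (hp _ _)).trans
    (A.le_jobCompletion ⟨j, Classical.arbitrary (T j)⟩)

open Classical in
/-- Tasks on one processor whose jobs complete by `t` take at most time `t`. -/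
theorem sum_le_of_jobCompletion_le (hp : ∀ i τ, 0 ≤ p i τ) (A : TaskSchedulingRun w p u) (i : P)
    {t : ℝ} (ht : 0 ≤ t) (s : Finset (Task T)) (hs : ∀ τ ∈ s, A.proc τ = i)
    (hst : ∀ τ ∈ s, A.jobCompletion τ.1 ≤ t) : ∑ τ ∈ s, p i τ ≤ t := by
  rcases s.eq_empty_or_nonempty with rfl | h
  · simpa using ht
  -- The task of `s` executed last completes only after all of `s`.
  obtain ⟨σ, hσ, hmax⟩ := exists_max_image s A.pos h
  refine le_trans ?_ ((A.le_jobCompletion σ).trans (hst σ hσ))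
  rw [start_add, hs σ hσ]
  refine sum_le_sum_of_subset_of_nonneg (fun τ hτ => ?_) fun _ _ _ => hp _ _
  simpa using ⟨hs τ hτ, hmax τ hτ⟩

open Classical in
/-- The total weighted completion time is at most `27 / 2` times that of every integral
schedule in which the tasks completed by time `t` on a processor take at most time `t`. -/
theorem sum_jobCompletion_le (hw : ∀ j, 0 < w j) (hp : ∀ i τ, 0 ≤ p i τ) (hu : IsTimeUnit p u)
    (A : TaskSchedulingRun w p u) (q : Task T → P)
    (F : Task T → ℝ) (D : J → ℝ) (hF : ∀ τ, 0 ≤ F τ)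
    (hload : ∀ i t, 0 ≤ t → ∑ τ ∈ univ.filter (fun τ => q τ = i ∧ F τ ≤ t), p i τ ≤ t)
    (hD : ∀ j, 0 ≤ D j) (hFD : ∀ τ, F τ ≤ D τ.1) :
    ∑ j, w j * A.jobCompletion j ≤ 27 / 2 * ∑ j, w j * D j := by
  obtain ⟨y, C, h⟩ := exists_lpFeasible hp hu q F D hF hload hD hFD
  calc ∑ j, w j * A.jobCompletion j ≤ ∑ j, w j * (27 / 2 * A.D j) :=
        sum_le_sum fun j _ => mul_le_mul_of_nonneg_left
          (sup'_le _ _ fun k _ => A.start_add_le_mul hp hu ⟨j, k⟩) (hw j).le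
    _ = 27 / 2 * ∑ j, w j * A.D j := by rw [mul_sum]; exact sum_congr rfl fun j _ => by ring
    _ ≤ _ := mul_le_mul_of_nonneg_left (A.optimal.optimal y C D h) (by norm_num)

end TaskSchedulingRun

end StageRun

/-! ### List scheduling with release times. -/

section Greedy

variable {X P : Type*} {proc : X → P} {dur release width : X → ℝ}

/-- Tasks are appended by increasing width, each as early as possible after its predecessors on the
processor. Since releases grow with the width, no task ever has to overtake one of smaller width. -/
theorem exists_isGreedy [Fintype X] (proc : X → P) (dur release width : X → ℝ)
    (hdur : ∀ τ, 0 ≤ dur τ) (hmono : ∀ τ τ', width τ ≤ width τ' → release τ ≤ release τ') :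
    ∃ start, IsGreedy proc dur release width start := by
  classical
  suffices h : ∀ s : Finset X, ∃ start : X → ℝ,
      (∀ τ ∈ s, release τ ≤ start τ) ∧
      (∀ τ ∈ s, ∀ τ' ∈ s, τ ≠ τ' → proc τ = proc τ' →
        start τ + dur τ ≤ start τ' ∨ start τ' + dur τ' ≤ start τ) ∧
      (∀ (i : P) (t : ℝ), (∀ τ ∈ s, proc τ = i → t ∉ Set.Ico (start τ) (start τ + dur τ)) →
        ∀ τ ∈ s, proc τ = i → release τ ≤ t → start τ ≤ t) ∧
      ∀ τ ∈ s, ∀ τ' ∈ s, proc τ = proc τ' → start τ < start τ' → width τ ≤ width τ' by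
    obtain ⟨start, h1, h2, h3, h4⟩ := h univ
    simp only [mem_univ, true_imp_iff] at h1 h2 h3 h4
    exact ⟨start, h1, h2, h3, fun τ τ' h h' _ => h4 τ τ' h h'⟩
  intro s
  induction s using Finset.induction_on_max_value width with
  | empty => exact ⟨0, by simp⟩
  | insert σ s hσ hmax ih =>
    obtain ⟨start, h1, h2, h3, h4⟩ := ih
    let ends : Finset ℝ := insert (release σ)
      ((s.filter fun τ => proc τ = proc σ).image fun τ => start τ + dur τ)
    have hne : ends.Nonempty := insert_nonempty _ _
    set v := ends.max' hne with hv
    have hrel : release σ ≤ v := le_max' _ _ (mem_insert_self _ _)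
    have hend : ∀ τ ∈ s, proc τ = proc σ → start τ + dur τ ≤ v := fun τ hτ h =>
      le_max' ends _ (mem_insert_of_mem (mem_image.2 ⟨τ, mem_filter.2 ⟨hτ, h⟩, rfl⟩))
    have hold : ∀ τ ∈ s, Function.update start σ v τ = start τ := fun τ hτ =>
      Function.update_of_ne (ne_of_mem_of_not_mem hτ hσ) _ _
    have hnew : Function.update start σ v σ = v := Function.update_self _ _ _
    refine ⟨Function.update start σ v, ?_, ?_, ?_, ?_⟩
    · simp only [forall_mem_insert, hnew]
      exact ⟨hrel, fun τ hτ => (hold τ hτ).symm ▸ h1 τ hτ⟩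
    · simp only [forall_mem_insert, hnew]
      refine ⟨⟨fun h => absurd rfl h, fun τ hτ _ h => ?_⟩,
        fun τ hτ => ⟨fun _ h => ?_, fun τ' hτ' => ?_⟩⟩
      · rw [hold τ hτ]; exact Or.inr (hend τ hτ h.symm)
      · rw [hold τ hτ]; exact Or.inl (hend τ hτ h)
      · rw [hold τ hτ, hold τ' hτ']; exact h2 τ hτ τ' hτ'
    · intro i t
      simp only [forall_mem_insert, hnew]
      rintro ⟨-, hidle⟩
      have hidle' : ∀ τ ∈ s, proc τ = i → t ∉ Set.Ico (start τ) (start τ + dur τ) := by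
        intro τ hτ
        rw [← hold τ hτ]
        exact hidle τ hτ
      -- At an idle time after the release of `σ`, all predecessors are released as well, so they
      -- have started, and hence ended.
      refine ⟨fun hi ht => max'_le _ _ _ fun b hb => ?_, fun τ hτ => ?_⟩
      · rcases mem_insert.1 hb with rfl | hb
        · exact ht
        · obtain ⟨τ, hτ, rfl⟩ := mem_image.1 hb
          obtain ⟨hτ, hp⟩ := mem_filter.1 hτ
          have hst := h3 i t hidle' τ hτ (hp.trans hi) ((hmono τ σ (hmax τ hτ)).trans ht)
          by_contra! hlt
          exact hidle' τ hτ (hp.trans hi) ⟨hst, hlt⟩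
      · rw [hold τ hτ]; exact h3 i t hidle' τ hτ
    · simp only [forall_mem_insert, hnew]
      refine ⟨⟨fun _ _ => le_rfl, fun τ hτ h hlt => ?_⟩,
        fun τ hτ => ⟨fun _ _ => hmax τ hτ, fun τ' hτ' => ?_⟩⟩
      · rw [hold τ hτ] at hlt
        linarith [hend τ hτ h.symm, hdur τ]
      · rw [hold τ hτ, hold τ' hτ']; exact h4 τ hτ τ' hτ'

open Classical in
/-- In a list schedule a task waits, from its release on, only for tasks of no larger width, if
all tasks that start earlier than its release are of no larger width. -/
theorem IsGreedy.start_add_le [Fintype X] {start : X → ℝ}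
    (h : IsGreedy proc dur release width start) (hdur : ∀ τ, 0 ≤ dur τ) (τ : X)
    (hearly : ∀ τ', start τ' < release τ → width τ' ≤ width τ) :
    start τ + dur τ ≤ release τ +
      ∑ τ' ∈ univ.filter (fun τ' => proc τ' = proc τ ∧ width τ' ≤ width τ), dur τ' := by
  set s := univ.filter fun τ' => proc τ' = proc τ ∧ width τ' ≤ width τ
  have hτ : τ ∈ s := by simp [s]
  -- Between release and start of `τ` the processor is never idle, by `busy`; whatever it runs
  -- started before `τ` and so has no larger width.
  have := sub_le_sum_of_Ico_cover (s.erase τ) start dur (b := release τ) (c := start τ)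
    (fun σ _ => hdur σ) fun v h1 h2 => by
      by_contra! hcon
      refine h2.not_ge (h.busy (proc τ) v (fun σ hσ hv => ?_) τ rfl h1)
      refine (hcon σ ?_ hv.1).not_gt hv.2
      have hlt : start σ < start τ := hv.1.trans_lt h2
      simp only [s, mem_erase, mem_filter, mem_univ, true_and]
      refine ⟨fun h => hlt.ne (congrArg start h), hσ, ?_⟩
      rcases lt_or_ge (start σ) (release τ) with h' | h'
      · exact hearly σ h'
      · exact h.smallest σ τ hσ hlt h'
  rw [← add_sum_erase _ _ hτ]
  linarith

end Greedy

/-! ### The Map-Shuffle-Reduce problem: blocks, stage ratios and the final schedule. -/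

section Problem

variable {J PM PR : Type*} {M R : J → Type*} {I : Instance J PM PR M R}

namespace SRSchedule

theorem reduceStart_le_completion (S : SRSchedule J PR M R) (I : Instance J PM PR M R)
    (τ : Task R) : S.reduceStart τ ≤ S.completion I τ :=
  le_add_of_nonneg_right (I.reduceTime_nonneg _ _)

theorem completion_le_jobCompletion [∀ j, Fintype (R j)] [∀ j, Nonempty (R j)]
    (S : SRSchedule J PR M R) (I : Instance J PM PR M R) (τ : Task R) :
    S.completion I τ ≤ S.jobCompletion I τ.1 :=
  le_sup' (fun r : R τ.1 => S.completion I ⟨τ.1, r⟩) (mem_univ τ.2)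

theorem Feasible.completion_nonneg {S : SRSchedule J PR M R} (h : S.Feasible I) (τ : Task R) :
    0 ≤ S.completion I τ :=
  (h.reduce_nonneg τ).trans (S.reduceStart_le_completion I τ)

theorem Feasible.jobCompletion_nonneg [∀ j, Fintype (R j)] [∀ j, Nonempty (R j)]
    {S : SRSchedule J PR M R} (h : S.Feasible I) (j : J) :
    0 ≤ S.jobCompletion I j :=
  (h.completion_nonneg ⟨j, Classical.arbitrary _⟩).trans (S.completion_le_jobCompletion I _)

end SRSchedule

variable [∀ j, Fintype (M j)]

theorem Instance.shuffleTotal_nonneg (I : Instance J PM PR M R) (τ : Task R) :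
    0 ≤ I.shuffleTotal τ := sum_nonneg fun _ _ => I.shuffleTime_nonneg _ _ _

theorem Instance.shuffleReduceTime_nonneg (I : Instance J PM PR M R) (i : PR) (τ : Task R) :
    0 ≤ I.shuffleReduceTime i τ :=
  add_nonneg (I.reduceTime_nonneg i τ) (I.shuffleTotal_nonneg τ)

namespace SRSchedule

variable {proc : Task R → PR} {block : Task R → ℝ} {order : ∀ j, R j → M j → ℕ}

theorem completion_ofBlocks (τ : Task R) :
    (ofBlocks I proc block order).completion I τ = block τ + I.shuffleReduceTime (proc τ) τ := by
  simp only [completion, ofBlocks, Instance.shuffleReduceTime]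
  ring

theorem le_shuffleStart_ofBlocks (j : J) (r : R j) (k : M j) :
    block ⟨j, r⟩ ≤ (ofBlocks I proc block order).shuffleStart j r k :=
  le_add_of_nonneg_right (sum_nonneg fun _ _ => I.shuffleTime_nonneg _ _ _)

theorem shuffleEnd_ofBlocks_le (horder : ∀ j r, Function.Injective (order j r))
    (j : J) (r : R j) (k : M j) :
    (ofBlocks I proc block order).shuffleStart j r k + I.shuffleTime j r k ≤
      block ⟨j, r⟩ + I.shuffleTotal ⟨j, r⟩ := by
  have h := offset_add (horder j r) (x := I.shuffleTime j r) (mem_univ k)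
  have h' : ∑ k' ∈ univ.filter (fun k' => order j r k' ≤ order j r k), I.shuffleTime j r k' ≤
      I.shuffleTotal ⟨j, r⟩ :=
    sum_le_sum_of_subset_of_nonneg (subset_univ _) fun _ _ _ => I.shuffleTime_nonneg _ _ _
  rw [← h, offset] at h'
  simp only [ofBlocks]
  rw [add_assoc]
  refine add_le_add_right (le_trans (le_of_eq ?_) h') _
  congr!

/-- A block reserves both paired processors for its whole length, so disjoint blocks cannot
conflict; inside one block the Shuffle tasks are laid out consecutively. -/
theorem feasible_ofBlocks (horder : ∀ j r, Function.Injective (order j r))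
    (hblock : ∀ τ, 0 ≤ block τ)
    (hseq : ∀ τ τ', τ ≠ τ' → proc τ = proc τ' →
      block τ + I.shuffleReduceTime (proc τ) τ ≤ block τ' ∨
      block τ' + I.shuffleReduceTime (proc τ') τ' ≤ block τ) :
    (ofBlocks I proc block order).Feasible I where
  shuffle_nonneg j r k := (hblock _).trans (le_shuffleStart_ofBlocks j r k)
  reduce_nonneg τ := add_nonneg (hblock τ) (I.shuffleTotal_nonneg τ)
  shuffle_disjoint := by
    intro j j' r k r' k' hne hproc
    by_cases h : (⟨j, r⟩ : Task R) = ⟨j', r'⟩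
    · obtain ⟨rfl, h⟩ := Sigma.mk.inj_iff.1 h
      obtain rfl := eq_of_heq h
      have hk : k ≠ k' := fun h => hne (by rw [h])
      have := offset_disjoint (s := univ) (horder j r) (x := I.shuffleTime j r)
        (fun _ _ => I.shuffleTime_nonneg _ _ _) (mem_univ k) (mem_univ k') hk
      rw [Set.disjoint_left] at this ⊢
      intro v hv hv'
      have e : ∀ k, (ofBlocks I proc block order).shuffleStart j r k =
          block ⟨j, r⟩ + offset univ (order j r) (I.shuffleTime j r) k := fun k => by
        simp only [ofBlocks, offset]
      simp only [e, Set.mem_Ico] at hv hv'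
      exact @this (v - block ⟨j, r⟩) ⟨by linarith [hv.1], by linarith [hv.2]⟩
        ⟨by linarith [hv'.1], by linarith [hv'.2]⟩
    · have hb (j : J) (r : R j) (k : M j) : block ⟨j, r⟩ ≤
          (ofBlocks I proc block order).shuffleStart j r k := le_shuffleStart_ofBlocks j r k
      have b1 := hb j r k
      have b2 := hb j' r' k'
      have hc (j : J) (r : R j) (k : M j) :
          (ofBlocks I proc block order).shuffleStart j r k + I.shuffleTime j r k ≤
            block ⟨j, r⟩ + I.shuffleTotal ⟨j, r⟩ := shuffleEnd_ofBlocks_le horder j r k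
      have c1 := hc j r k
      have c2 := hc j' r' k'
      have d1 := I.reduceTime_nonneg (proc ⟨j, r⟩) ⟨j, r⟩
      have d2 := I.reduceTime_nonneg (proc ⟨j', r'⟩) ⟨j', r'⟩
      rw [Set.disjoint_left]
      rintro v ⟨h1, h2⟩ ⟨h3, h4⟩
      rcases hseq _ _ h hproc with h | h <;> rw [Instance.shuffleReduceTime] at h <;> linarith
  reduce_disjoint := by
    intro τ τ' hne hproc
    have b1 := I.shuffleTotal_nonneg τ
    have b2 := I.shuffleTotal_nonneg τ'
    rw [Set.disjoint_left]
    rintro v ⟨h1, h2⟩ ⟨h3, h4⟩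
    rw [completion_ofBlocks] at h2 h4
    simp only [ofBlocks] at h1 h3
    rcases hseq _ _ hne hproc with h | h <;> linarith
  shuffle_reduce j r k := shuffleEnd_ofBlocks_le horder j r k

variable {S : SRSchedule J PR M R}

variable [Fintype J] [∀ j, Fintype (R j)]

open Classical in
/-- The Shuffle-Reduce tasks completed by time `t` on a processor of a feasible schedule take at
most time `2 * t`, as they run on two processors. -/
theorem Feasible.load_le (h : S.Feasible I) (i : PR) {t : ℝ} (ht : 0 ≤ t) :
    ∑ τ ∈ univ.filter (fun τ => S.reduceProc τ = i ∧ S.completion I τ ≤ t),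
      I.shuffleReduceTime i τ ≤ 2 * t := by
  set s := univ.filter fun τ => S.reduceProc τ = i ∧ S.completion I τ ≤ t
  have hs : ∀ τ ∈ s, S.reduceProc τ = i ∧ S.completion I τ ≤ t := fun τ hτ => by
    simpa [s] using hτ
  have hred : ∑ τ ∈ s, I.reduceTime i τ ≤ t := by
    rw [sum_congr rfl fun τ hτ => show I.reduceTime i τ = I.reduceTime (S.reduceProc τ) τ by
      rw [(hs τ hτ).1]]
    exact sum_le_of_disjoint_Ico s S.reduceStart _ ht (fun τ _ => I.reduceTime_nonneg _ _)
      (fun τ _ => h.reduce_nonneg τ) (fun τ hτ => (hs τ hτ).2) fun τ hτ τ' hτ' hne =>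
        h.reduce_disjoint τ τ' hne ((hs τ hτ).1.trans (hs τ' hτ').1.symm)
  have hshuf : ∑ τ ∈ s, I.shuffleTotal τ ≤ t := by
    have := sum_le_of_disjoint_Ico (s.sigma fun τ => (univ : Finset (M τ.1)))
      (fun q => S.shuffleStart q.1.1 q.1.2 q.2) (fun q => I.shuffleTime q.1.1 q.1.2 q.2) ht
      (fun q _ => I.shuffleTime_nonneg _ _ _) (fun q _ => h.shuffle_nonneg _ _ _)
      (fun q hq => ((h.shuffle_reduce _ _ _).trans (S.reduceStart_le_completion I _)).trans
        (hs q.1 (mem_sigma.1 hq).1).2) ?_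
    · rwa [sum_sigma] at this
    · rintro ⟨⟨j, r⟩, k⟩ hq ⟨⟨j', r'⟩, k'⟩ hq' hne
      refine h.shuffle_disjoint j j' r k r' k' (fun heq => hne ?_)
        ((hs _ (mem_sigma.1 hq).1).1.trans (hs _ (mem_sigma.1 hq').1).1.symm)
      cases heq
      rfl
  simp only [Instance.shuffleReduceTime, sum_add_distrib]
  linarith

end SRSchedule

variable [Fintype J] [∀ j, Fintype (R j)] [∀ j, Nonempty (R j)] {u : ℝ}

/-- Doubling the completion times of `S` absorbs the load bound `2 * t`, so the stage bound `27 / 2`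
is paid twice. -/
theorem sum_srRun_jobCompletion_le [Fintype PR] [Nonempty PR]
    (hu : IsTimeUnit I.shuffleReduceTime u) (B : TaskSchedulingRun I.weight I.shuffleReduceTime u)
    {S : SRSchedule J PR M R} (hS : S.Feasible I) :
    ∑ j, I.weight j * B.jobCompletion j ≤ 27 * S.cost I := by
  have h := B.sum_jobCompletion_le I.weight_pos I.shuffleReduceTime_nonneg hu S.reduceProc
    (fun τ => 2 * S.completion I τ) (fun j => 2 * S.jobCompletion I j)
    (fun τ => mul_nonneg zero_le_two (hS.completion_nonneg τ))
    (fun i t ht => by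
      have := hS.load_le i (t := t / 2) (by positivity)
      refine (sum_le_sum_of_subset_of_nonneg (fun τ hτ => ?_)
        fun _ _ _ => I.shuffleReduceTime_nonneg _ _).trans (this.trans_eq (by ring))
      simp only [mem_filter, mem_univ, true_and] at hτ ⊢
      exact ⟨hτ.1, by linarith [hτ.2]⟩)
    (fun j => mul_nonneg zero_le_two (hS.jobCompletion_nonneg j))
    (fun τ => mul_le_mul_of_nonneg_left (S.completion_le_jobCompletion I τ) zero_le_two)
  refine h.trans (le_of_eq ?_)
  rw [SRSchedule.cost, mul_sum, mul_sum]
  exact sum_congr rfl fun j _ => by ring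

/-- Map tasks precede the Reduce tasks of their job, so the job completion times of `S` bound those
of the Map stage without any loss. -/
theorem sum_mapRun_jobCompletion_le [Fintype PM] [Nonempty PM] [∀ j, Nonempty (M j)]
    (hu : IsTimeUnit I.mapTime u) (A : TaskSchedulingRun I.weight I.mapTime u)
    {S : Schedule J PM PR M R} (hS : S.Feasible I) :
    ∑ j, I.weight j * A.jobCompletion j ≤ 27 / 2 * S.cost I := by
  classical
  have hnn : ∀ τ, 0 ≤ S.mapStart τ + I.mapTime (S.mapProc τ) τ := fun τ =>
    add_nonneg (hS.map_nonneg τ) (I.mapTime_nonneg _ _)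
  refine A.sum_jobCompletion_le I.weight_pos I.mapTime_nonneg hu S.mapProc
    (fun τ => S.mapStart τ + I.mapTime (S.mapProc τ) τ) (fun j => S.jobCompletion I j)
    hnn (fun i t ht => ?_) hS.shuffleReduce.jobCompletion_nonneg (fun τ => ?_)
  · rw [sum_congr rfl fun τ hτ => show I.mapTime i τ = I.mapTime (S.mapProc τ) τ by
      rw [(mem_filter.1 hτ).2.1]]
    refine sum_le_of_disjoint_Ico _ S.mapStart _ ht (fun τ _ => I.mapTime_nonneg _ _)
      (fun τ _ => hS.map_nonneg τ) (fun τ hτ => (mem_filter.1 hτ).2.2) fun τ hτ τ' hτ' hne =>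
        hS.map_disjoint τ τ' hne ((mem_filter.1 hτ).2.1.trans (mem_filter.1 hτ').2.1.symm)
  · exact (hS.map_reduce τ.1 τ.2 (Classical.arbitrary _)).trans
      ((S.reduceStart_le_completion I _).trans (S.completion_le_jobCompletion I _))

variable [Fintype PM] [Nonempty PM] [Fintype PR] [Nonempty PR] [∀ j, Nonempty (M j)]

theorem width_nonneg (A : TaskSchedulingRun I.weight I.mapTime u)
    (B : TaskSchedulingRun I.weight I.shuffleReduceTime u) (j : J) : 0 ≤ width A B j :=
  (A.jobCompletion_nonneg I.mapTime_nonneg j).trans (le_max_left _ _)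

theorem nonempty_mrsRun (huM : IsTimeUnit I.mapTime u) (huR : IsTimeUnit I.shuffleReduceTime u) :
    Nonempty (MRSRun I u) := by
  obtain ⟨A⟩ := nonempty_taskSchedulingRun I.weight_pos I.mapTime_nonneg huM
  obtain ⟨B⟩ := nonempty_taskSchedulingRun I.weight_pos I.shuffleReduceTime_nonneg huR
  obtain ⟨mapStart, hM⟩ := exists_isGreedy A.proc (fun τ => I.mapTime (A.proc τ) τ)
    (fun _ => 0) (fun τ => width A B τ.1) (fun τ => I.mapTime_nonneg _ _) fun _ _ _ => le_rfl
  obtain ⟨block, hR⟩ := exists_isGreedy B.proc (fun τ => I.shuffleReduceTime (B.proc τ) τ)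
    (fun τ => width A B τ.1) (fun τ => width A B τ.1) (fun τ => I.shuffleReduceTime_nonneg _ _)
    fun _ _ h => h
  exact ⟨{
    mapRun := A, srRun := B
    order := fun j _ k => Fintype.equivFin (M j) k
    order_injective := fun j _ => Fin.val_injective.comp (Fintype.equivFin (M j)).injective
    mapStart := mapStart, map_greedy := hM, block := block, sr_greedy := hR }⟩

namespace MRSRun

theorem feasible_stageSchedule (A : MRSRun I u) : A.stageSchedule.Feasible I :=
  SRSchedule.feasible_ofBlocks A.order_injective
    (A.srRun.start_nonneg I.shuffleReduceTime_nonneg)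
    fun _ _ h h' => A.srRun.sequential I.shuffleReduceTime_nonneg h h'

theorem cost_stageSchedule (A : MRSRun I u) :
    A.stageSchedule.cost I = ∑ j, I.weight j * A.srRun.jobCompletion j := by
  simp only [SRSchedule.cost, SRSchedule.jobCompletion, stageSchedule,
    SRSchedule.completion_ofBlocks, TaskSchedulingRun.jobCompletion]

/-- The Map tasks of a job complete by its width. -/
theorem mapStart_add_le (A : MRSRun I u) (τ : Task M) :
    A.mapStart τ + I.mapTime (A.mapRun.proc τ) τ ≤ width A.mapRun A.srRun τ.1 := by
  classical
  -- Nothing starts before time `0`, so the condition on early starters is vacuous.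
  refine (A.map_greedy.start_add_le (fun _ => I.mapTime_nonneg _ _) τ
    fun σ hσ => absurd (A.map_greedy.released σ) hσ.not_ge).trans ?_
  rw [zero_add, sum_congr rfl fun σ hσ => show _ = I.mapTime (A.mapRun.proc τ) σ by
    rw [(mem_filter.1 hσ).2.1]]
  exact A.mapRun.sum_le_of_jobCompletion_le I.mapTime_nonneg _ (width_nonneg _ _ _) _
    (fun σ hσ => (mem_filter.1 hσ).2.1)
    fun σ hσ => (le_max_left _ _).trans (mem_filter.1 hσ).2.2

/-- The Shuffle-Reduce tasks of a job complete by twice its width. -/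
theorem block_add_le (A : MRSRun I u) (τ : Task R) :
    A.block τ + I.shuffleReduceTime (A.srRun.proc τ) τ ≤
      2 * width A.mapRun A.srRun τ.1 := by
  classical
  -- Release times equal widths, so a task that starts before the release of `τ` has smaller width.
  refine (A.sr_greedy.start_add_le (fun _ => I.shuffleReduceTime_nonneg _ _) τ
    fun σ hσ => (A.sr_greedy.released σ).trans hσ.le).trans ?_
  rw [two_mul, sum_congr rfl fun σ hσ => show _ = I.shuffleReduceTime (A.srRun.proc τ) σ by
    rw [(mem_filter.1 hσ).2.1]]
  exact add_le_add_right (A.srRun.sum_le_of_jobCompletion_le I.shuffleReduceTime_nonneg _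
    (width_nonneg _ _ _) _ (fun σ hσ => (mem_filter.1 hσ).2.1)
    fun σ hσ => (le_max_right _ _).trans (mem_filter.1 hσ).2.2) _

/-- The width separates the phases of a job: its Map tasks end by then, and its blocks start no
earlier. -/
theorem feasible_schedule (A : MRSRun I u) : A.schedule.Feasible I where
  shuffleReduce := SRSchedule.feasible_ofBlocks A.order_injective
    (fun τ => (width_nonneg _ _ _).trans (A.sr_greedy.released τ)) A.sr_greedy.sequential
  map_nonneg := A.map_greedy.released
  map_disjoint τ τ' hne hproc := by
    rw [Set.disjoint_left]
    rintro v ⟨h1, h2⟩ ⟨h3, h4⟩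
    rcases A.map_greedy.sequential τ τ' hne hproc with h | h
    · exact absurd (h2.trans_le h) h3.not_gt
    · exact absurd (h4.trans_le h) h1.not_gt
  map_shuffle j r k := ((A.mapStart_add_le ⟨j, k⟩).trans (A.sr_greedy.released ⟨j, r⟩)).trans
    (SRSchedule.le_shuffleStart_ofBlocks j r k)
  map_reduce j k r := ((A.mapStart_add_le ⟨j, k⟩).trans (A.sr_greedy.released ⟨j, r⟩)).trans
    (le_add_of_nonneg_right (I.shuffleTotal_nonneg _))

/-- The width, a maximum of two nonnegative numbers, is replaced by their sum, so that each stage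
can be compared with the optimum separately. -/
theorem cost_schedule_le (A : MRSRun I u) :
    A.schedule.cost I ≤ 2 * (∑ j, I.weight j * A.mapRun.jobCompletion j +
      ∑ j, I.weight j * A.srRun.jobCompletion j) := by
  rw [← sum_add_distrib, mul_sum]
  refine sum_le_sum fun j _ => ?_
  rw [← mul_add, mul_left_comm]
  refine mul_le_mul_of_nonneg_left (sup'_le _ _ fun r _ => ?_) (I.weight_pos j).le
  refine (SRSchedule.completion_ofBlocks (I := I) ⟨j, r⟩).trans_le
    ((A.block_add_le ⟨j, r⟩).trans (mul_le_mul_of_nonneg_left ?_ zero_le_two))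
  exact max_le_add_of_nonneg (A.mapRun.jobCompletion_nonneg I.mapTime_nonneg j)
    (A.srRun.jobCompletion_nonneg I.shuffleReduceTime_nonneg j)

end MRSRun

end Problem

end MapReduce

end

theorem corollary1 {J PM PR : Type*} {M R : J → Type*}
    [Fintype J] [Fintype PM] [Nonempty PM] [Fintype PR] [Nonempty PR]
    [∀ j, Fintype (M j)] [∀ j, Nonempty (M j)] [∀ j, Fintype (R j)] [∀ j, Nonempty (R j)]
    (I : MapReduce.Instance J PM PR M R) (u : ℝ)
    (huM : MapReduce.IsTimeUnit I.mapTime u)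
    (huR : MapReduce.IsTimeUnit I.shuffleReduceTime u) :
    Nonempty (MapReduce.MRSRun I u) ∧
    ∀ A : MapReduce.MRSRun I u,
      (A.stageSchedule.Feasible I ∧
        ∀ S : MapReduce.SRSchedule J PR M R, S.Feasible I →
          A.stageSchedule.cost I ≤ 27 * S.cost I) ∧
      (A.schedule.Feasible I ∧
        ∀ S : MapReduce.Schedule J PM PR M R, S.Feasible I →
          A.schedule.cost I ≤ 81 * S.cost I) := by
  refine ⟨MapReduce.nonempty_mrsRun huM huR, fun A =>
    ⟨⟨A.feasible_stageSchedule, fun S hS => ?_⟩, A.feasible_schedule, fun S hS => ?_⟩⟩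
  · rw [A.cost_stageSchedule]
    exact MapReduce.sum_srRun_jobCompletion_le huR A.srRun hS
  · have h := A.cost_schedule_le
    have hM := MapReduce.sum_mapRun_jobCompletion_le huM A.mapRun hS
    have hR := MapReduce.sum_srRun_jobCompletion_le huR A.srRun hS.shuffleReduce
    -- `2 * (27 / 2 + 27) = 81`.
    linarith
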